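/- Fix $g_2\in\mathbb{C}$. On $\mathbb{P}^2$ over $\mathbb{C}$ with homogeneous coordinates $[x_0:x_1:x_2]=[1:q:p]$ put $(u_0,v_0)=(x_0/x_2,\,x_1/x_2)$, and let $S=\mathrm{Bl}_{b_9}\cdots \mathrm{Bl}_{b_1}\mathbb{P}^2$, with $\varepsilon:S\to\mathbb{P}^2$ the composition of the nine blow-ups, where $b_{n+1}$ $(0\le n\le 8)$ is the point $(u_n,v_n)=(a_n,0)$ with $a_3=4$, $a_7=-16g_2$ and $a_n=0$ for all other $n$, and where $(u_{n+1},v_{n+1})$ are the coordinates on the affine chart of the blow-up of $b_{n+1}$ given by $u_n=a_n+u_{n+1}v_{n+1}$, $v_n=v_{n+1}$. Let $E_i\in\mathrm{Div}(S)$ be the pull-back to $S$ of the exceptional curve of the blow-up of $b_i$, let $H=\varepsilon^*V(x_0)$, and put $$D_0=E_8-E_9,\qquad D_i=E_i-E_{i+1}\ (1\le i\le 7),\qquad D_8=H-E_1-E_2-E_3,$$ $$D=D_0+2D_1+4D_2+6D_3+5D_4+4D_5+3D_6+2D_7+3D_8 .$$ For $g_3\in\mathbb{C}$ let $\widehat C_{g_2,g_3}\subset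 S$ be the strict transform under $\varepsilon$ of the Weierstrass cubic $$C_{g_2,g_3}=V\!\left(x_0x_2^2-4x_1^3+g_2x_0^2x_1+g_3x_0^3\right)\subset\mathbb{P}^2 .$$ Then the anticanonical linear system $|-K_S|$ (the set of effective divisors linearly equivalent to $-K_S$, identified with $\mathbb{P}H^0(S,\mathscr{O}_S(-K_S))$) has dimension $\dim|-K_S|=1$. It consists exactly of $D$ and the curves $\widehat C_{g_2,g_3}$, $g_3\in\mathbb{C}$, and there is an isomorphism of projective spaces $$|-K_S|\longrightarrow\mathbb{P}^1,\qquad D\longmapsto[0:1],\qquad \widehat C_{g_2,g_3}\longmapsto[1:g_3]\quad(g_3\in\mathbb{C}).$$ -/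

import Mathlib

open scoped LinearAlgebra.Projectivization

noncomputable section

namespace AutP1

/-! ### Surfaces as models of their function field

A rational surface is described by its function field `K = ℂ(q, p)` together with the set of the
local rings `𝒪_{S,η} ⊆ K` at all its scheme-theoretic points `η` (closed points, generic points of
irreducible curves, and the generic point of the surface).  This is Zariski's notion of a model of
`K / ℂ`. A separated integral surface is determined by this set, and birational morphisms that are
the identity on `K` are domination of local rings. -/

/-- The field `ℂ(q, p)` of rational functions of the plane. -/
abbrev K : Type := FractionRing (MvPolynomial (Fin 2) ℂ)

/-- The affine coordinate `q`. -/
def q : K := algebraMap (MvPolynomial (Fin 2) ℂ) K (MvPolynomial.X 0)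

/-- The affine coordinate `p`. -/
def p : K := algebraMap (MvPolynomial (Fin 2) ℂ) K (MvPolynomial.X 1)

/-- The model of the affine variety `Spec ℂ[s]`, for a set `s ⊆ K` of coordinate functions:
all localizations of the ring `ℂ[s] ⊆ K` at its prime ideals. -/
def affineModel (s : Set K) : Set (LocalSubring K) :=
  {R | ∃ (P : Ideal (Algebra.adjoin ℂ s).toSubring) (_ : P.IsPrime),
    R = LocalSubring.ofPrime (Algebra.adjoin ℂ s).toSubring P}

/-- The rational function `f` is regular at the point with local ring `R`, and vanishes there. -/
def VanishesAt (f : K) (R : LocalSubring K) : Prop :=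
  ∃ h : f ∈ R.toSubring, (⟨f, h⟩ : R.toSubring) ∈ IsLocalRing.maximalIdeal R.toSubring

/-- The homogeneous coordinates `[x₀ : x₁ : x₂] = [1 : q : p]`. -/
def homCoord : Fin 3 → K := ![1, q, p]

/-- The projective plane: the union of its three standard affine charts, the `i`-th one having
the coordinate functions `x_j / x_i`. -/
def projPlane : Set (LocalSubring K) :=
  ⋃ i : Fin 3, affineModel (Set.range fun j => homCoord j / homCoord i)

/-- The blow-up of a surface `M` at the closed point with coordinates `(u, v) = (a, 0)`, where
`(u, v)` are the coordinates of an affine chart `𝔸²_{(u,v)}` of `M`.  The point is removed, and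
replaced by the points lying over it in the two affine charts
`𝔸²_{(U,V)} → 𝔸²_{(u,v)}`, `(U, V) ↦ (a + V, U V)`, and
`𝔸²_{(u',v')} → 𝔸²_{(u,v)}`, `(u', v') ↦ (a + u' v', v')`. -/
def blowUp (M : Set (LocalSubring K)) (u v : K) (a : ℂ) : Set (LocalSubring K) :=
  {R ∈ M | ¬ (VanishesAt (u - algebraMap ℂ K a) R ∧ VanishesAt v R)} ∪
  {R ∈ affineModel {v / (u - algebraMap ℂ K a), u - algebraMap ℂ K a} ∪
        affineModel {(u - algebraMap ℂ K a) / v, v} |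
      VanishesAt (u - algebraMap ℂ K a) R ∧ VanishesAt v R}

/-! ### Divisors -/

/-- A prime divisor of a smooth surface `M`, given by the local ring of `M` at its generic point.
The points of codimension one are exactly those whose local ring is a discrete
valuation ring. -/
structure PrimeDivisor (M : Set (LocalSubring K)) where
  /-- the local ring at the generic point -/
  ring : ValuationSubring K
  mem : ring.toLocalSubring ∈ M
  dvr : IsDiscreteValuationRing ring

attribute [instance] PrimeDivisor.dvr

variable {M : Set (LocalSubring K)}

/-- The order `ord_V(f) ∈ ℤ` of a nonzero rational function `f` along a prime divisor `V`
(and `0` for `f = 0`). -/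
def PrimeDivisor.ord (V : PrimeDivisor M) (f : K) : ℤ :=
  -WithZero.log ((IsDiscreteValuationRing.maximalIdeal V.ring).valuation K f)

/-- Formal integral combinations of prime divisors. The divisors are those of finite support. -/
abbrev FormalDivisor (M : Set (LocalSubring K)) : Type := PrimeDivisor M → ℤ

/-- The divisor of a nonzero rational function. -/
def divFun (M : Set (LocalSubring K)) (f : K) : FormalDivisor M := fun V => V.ord f

open scoped KaehlerDifferential in
/-- Rational 2-forms. -/
abbrev TwoForm : Type := ⋀[K]^2 Ω[K⁄ℂ]

/-- The 2-forms that are regular at the generic point of `V`: the `𝒪_V`-module generated by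
the forms `df ∧ dg` with `f, g ∈ 𝒪_V`. -/
def PrimeDivisor.regularForms (V : PrimeDivisor M) : Submodule V.ring TwoForm :=
  Submodule.span V.ring {η | ∃ f ∈ V.ring, ∃ g ∈ V.ring,
    η = exteriorPower.ιMulti K 2 ![KaehlerDifferential.D ℂ K f, KaehlerDifferential.D ℂ K g]}

/-- The order along `V` of a nonzero rational 2-form `η`: the largest order of a function `f`
such that `η / f` is regular at the generic point of `V`. -/
def PrimeDivisor.ordForm (V : PrimeDivisor M) (η : TwoForm) : ℤ :=
  sSup {n : ℤ | ∃ f : K, f ≠ 0 ∧ V.ord f = n ∧ f⁻¹ • η ∈ V.regularForms}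

/-- The divisor of a nonzero rational 2-form; these are the canonical divisors of `M`. -/
def divForm (M : Set (LocalSubring K)) (η : TwoForm) : FormalDivisor M := fun V => V.ordForm η

/-- Linear equivalence of divisors. -/
def LinEquiv (D D' : FormalDivisor M) : Prop := ∃ f : K, f ≠ 0 ∧ D - D' = divFun M f

/-- The complete linear system `|D|`: the effective divisors linearly equivalent to `D`. -/
def linearSystem (D : FormalDivisor M) : Set (FormalDivisor M) :=
  {D' | D'.support.Finite ∧ 0 ≤ D' ∧ LinEquiv D' D}

lemma PrimeDivisor.ord_mul (V : PrimeDivisor M) {f g : K} (hf : f ≠ 0) (hg : g ≠ 0) :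
    V.ord (f * g) = V.ord f + V.ord g := by
  unfold PrimeDivisor.ord
  rw [map_mul, WithZero.log_mul (by simpa using hf) (by simpa using hg)]
  ring

lemma PrimeDivisor.le_ord_add (V : PrimeDivisor M) {f g : K} (hf : f ≠ 0) (hg : g ≠ 0)
    (hfg : f + g ≠ 0) : min (V.ord f) (V.ord g) ≤ V.ord (f + g) := by
  unfold PrimeDivisor.ord
  have h := ((IsDiscreteValuationRing.maximalIdeal V.ring).valuation K).map_add f g
  rcases le_max_iff.1 h with h | h
  · have := (WithZero.log_le_log (by simpa using hfg) (by simpa using hf)).2 h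
    exact (min_le_left _ _).trans (by linarith)
  · have := (WithZero.log_le_log (by simpa using hfg) (by simpa using hg)).2 h
    exact (min_le_right _ _).trans (by linarith)

lemma PrimeDivisor.ord_pow (V : PrimeDivisor M) (f : K) (n : ℕ) :
    V.ord (f ^ n) = n * V.ord f := by
  unfold PrimeDivisor.ord
  rw [map_pow, WithZero.log_pow]
  simp

lemma PrimeDivisor.ord_algebraMap (V : PrimeDivisor M) (c : ℂ) :
    V.ord (algebraMap ℂ K c) = 0 := by
  obtain ⟨d, hd⟩ := IsAlgClosed.exists_pow_nat_eq c
    (n := (V.ord (algebraMap ℂ K c)).natAbs + 1) (Nat.succ_pos _)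
  have h : V.ord (algebraMap ℂ K c) =
      ((V.ord (algebraMap ℂ K c)).natAbs + 1 : ℕ) * V.ord (algebraMap ℂ K d) := by
    rw [← V.ord_pow, ← map_pow, hd]
  refine Int.eq_zero_of_abs_lt_dvd (m := ((V.ord (algebraMap ℂ K c)).natAbs + 1 : ℕ)) ⟨_, h⟩ ?_
  rw [Int.abs_eq_natAbs]
  push_cast
  linarith

/-- The space of global sections `H⁰(M, 𝒪_M(D)) = {f | f = 0 or div f + D ≥ 0}`. -/
def globalSections (D : FormalDivisor M) : Submodule ℂ K where
  carrier := {f | f ≠ 0 → 0 ≤ divFun M f + D}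
  zero_mem' := fun h => absurd rfl h
  add_mem' := by
    intro f g hf hg hfg V
    by_cases hf0 : f = 0
    · subst hf0
      simpa using hg (by simpa using hfg) V
    by_cases hg0 : g = 0
    · subst hg0
      simpa using hf (by simpa using hfg) V
    have h1 := hf hf0 V
    have h2 := hg hg0 V
    have h3 := V.le_ord_add hf0 hg0 hfg
    simp only [Pi.zero_apply, Pi.add_apply, divFun] at h1 h2 ⊢
    rcases min_le_iff.1 h3 with h | h <;> linarith
  smul_mem' := by
    intro c f hf hcf V
    rw [Algebra.smul_def] at hcf
    obtain ⟨hc, hf0⟩ := mul_ne_zero_iff.1 hcf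
    have h1 := hf hf0 V
    simp only [Pi.zero_apply, Pi.add_apply, divFun, Algebra.smul_def] at h1 ⊢
    rw [V.ord_mul hc hf0, V.ord_algebraMap, zero_add]
    exact h1

/-- The dimension of the complete linear system `|D| = ℙ H⁰(M, 𝒪_M(D))`. -/
def linearSystemDim (D : FormalDivisor M) : ℤ :=
  (Module.finrank ℂ (globalSections D) : ℤ) - 1

/-- A bijection `|D| → ℙ¹` is an isomorphism of projective spaces if, under the identification
of `|D|` with `ℙ H⁰(M, 𝒪_M(D))` by `[s] ↦ div s + D`, it is induced by a linear isomorphism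
`H⁰(M, 𝒪_M(D)) ≃ ℂ²`. -/
def IsProjectiveIso (D : FormalDivisor M) (Φ : linearSystem D ≃ ℙ ℂ (Fin 2 → ℂ)) : Prop :=
  ∃ e : globalSections D ≃ₗ[ℂ] (Fin 2 → ℂ),
    ∀ (s : globalSections D) (hs : s ≠ 0) (D' : linearSystem D),
      (D' : FormalDivisor M) = divFun M (s : K) + D →
        Φ D' = Projectivization.mk ℂ (e s) (e.map_ne_zero_iff.2 hs)

/-- For a surface `M` with a birational morphism to `ℙ²`, the pull-back to `M` of the divisor
`V(F)` of a nonzero homogeneous polynomial `F` of degree `d`: its coefficient along `V` is the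
order of the local equation `F / x_i ^ d`, where `x_i` is a coordinate of minimal order. -/
def formDivisor (M : Set (LocalSubring K)) (d : ℕ) (F : MvPolynomial (Fin 3) ℂ) :
    FormalDivisor M := fun V =>
  V.ord (MvPolynomial.aeval homCoord F) - d * min 0 (min (V.ord q) (V.ord p))

open Classical in
/-- The strict transform on `M'` of a divisor `C` on `M`, where `M'` is obtained from `M` by
blowing up closed points: a prime divisor of `M'` which is a prime divisor of `M` (that is, has the
same local ring at its generic point) keeps its coefficient, and the curves contracted by
`M' → M` get the coefficient `0`. -/
def strictTransform (M' : Set (LocalSubring K)) (C : FormalDivisor M) : FormalDivisor M' :=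
  fun V => if h : V.ring.toLocalSubring ∈ M then C ⟨V.ring, h, V.dvr⟩ else 0

open Classical in
/-- For a surface `M` lying over the blow-up at the point `(u, v) = (a, 0)`, the pull-back to `M`
of the exceptional curve of this blow-up.  It is the divisor of the inverse image on `M` of the
ideal `(u - a, v)` of the point, and supported on the curves mapped to the point. -/
def excDivisor (M : Set (LocalSubring K)) (u v : K) (a : ℂ) : FormalDivisor M := fun V =>
  if VanishesAt (u - algebraMap ℂ K a) V.ring.toLocalSubring ∧
      VanishesAt v V.ring.toLocalSubring then
    min (V.ord (u - algebraMap ℂ K a)) (V.ord v)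
  else 0

/-! ### The surface -/

/-- The point `b_{n+1}` has coordinates `(u_n, v_n) = (centre g₂ n, 0)`. -/
def centre (g₂ : ℂ) (n : ℕ) : ℂ := if n = 3 then 4 else if n = 7 then -16 * g₂ else 0

/-- The coordinates `(u_n, v_n)`, starting from `(u_0, v_0) = (z, w) = (x₀ / x₂, x₁ / x₂)`,
with `u_n = centre g₂ n + u_{n+1} v_{n+1}` and `v_n = v_{n+1}`. -/
def coord (g₂ : ℂ) : ℕ → K × K
  | 0 => (1 / p, q / p)
  | n + 1 => (((coord g₂ n).1 - algebraMap ℂ K (centre g₂ n)) / (coord g₂ n).2, (coord g₂ n).2)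

/-- The surface `Bl_{b_n} ⋯ Bl_{b_1} ℙ²`. -/
def stage (g₂ : ℂ) : ℕ → Set (LocalSubring K)
  | 0 => projPlane
  | n + 1 => blowUp (stage g₂ n) (coord g₂ n).1 (coord g₂ n).2 (centre g₂ n)

/-- The surface `S = Bl_{b_9} ⋯ Bl_{b_1} ℙ²`. -/
def surfaceS (g₂ : ℂ) : Set (LocalSubring K) := stage g₂ 9

/-- The pull-back `E_i` to `S` of the exceptional curve of the blow-up of `b_i`,
for `1 ≤ i ≤ 9`. -/
def E (g₂ : ℂ) (i : ℕ) : FormalDivisor (surfaceS g₂) :=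
  excDivisor (surfaceS g₂) (coord g₂ (i - 1)).1 (coord g₂ (i - 1)).2 (centre g₂ (i - 1))

/-- The pull-back `H` to `S` of the line `x₀ = 0`. -/
def H (g₂ : ℂ) : FormalDivisor (surfaceS g₂) := formDivisor (surfaceS g₂) 1 (MvPolynomial.X 0)

/-- The curves `D_0 = E_8 - E_9`, `D_i = E_i - E_{i+1}` for `1 ≤ i ≤ 7`, and
`D_8 = H - E_1 - E_2 - E_3`. -/
def Dcomp (g₂ : ℂ) (i : Fin 9) : FormalDivisor (surfaceS g₂) :=
  if i = 0 then E g₂ 8 - E g₂ 9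
  else if i = 8 then H g₂ - E g₂ 1 - E g₂ 2 - E g₂ 3
  else E g₂ i - E g₂ (i + 1)

/-- `D = D_0 + 2 D_1 + 4 D_2 + 6 D_3 + 5 D_4 + 4 D_5 + 3 D_6 + 2 D_7 + 3 D_8`. -/
def D (g₂ : ℂ) : FormalDivisor (surfaceS g₂) :=
  ∑ i : Fin 9, (![1, 2, 4, 6, 5, 4, 3, 2, 3] i : ℤ) • Dcomp g₂ i

open MvPolynomial in
/-- The Weierstrass cubic form `x₀ x₂² - 4 x₁³ + g₂ x₀² x₁ + g₃ x₀³`. -/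
def weierstrassForm (g₂ g₃ : ℂ) : MvPolynomial (Fin 3) ℂ :=
  X 0 * X 2 ^ 2 - 4 * X 1 ^ 3 + C g₂ * X 0 ^ 2 * X 1 + C g₃ * X 0 ^ 3

/-- The strict transform on `S` of the Weierstrass cubic
`C_{g₂,g₃} = V(x₀ x₂² - 4 x₁³ + g₂ x₀² x₁ + g₃ x₀³) ⊆ ℙ²`. -/
def weierstrassStrict (g₂ g₃ : ℂ) : FormalDivisor (surfaceS g₂) :=
  strictTransform (surfaceS g₂) (formDivisor projPlane 3 (weierstrassForm g₂ g₃))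

/-- The anticanonical divisor `-K_S = -div η` defined by a nonzero rational 2-form `η`. -/
def antiK (g₂ : ℂ) (η : TwoForm) : FormalDivisor (surfaceS g₂) := -divForm (surfaceS g₂) η

/-- The point `[a : b]` of `ℙ¹`. -/
def point (a b : ℂ) (h : (![a, b] : Fin 2 → ℂ) ≠ 0) : ℙ ℂ (Fin 2 → ℂ) :=
  Projectivization.mk ℂ ![a, b] h

end AutP1

end

/-!
The sections of the sheaf of `-K_S` are computed explicitly.

All prime divisors of `S` are known: a discrete valuation ring that belongs to the model `S` is
either a local ring of `ℙ²`, and then it is not affected by the blow-ups, or the local ring of the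
curve `v = 0` in one of the charts with coordinates `(u_n, v)`, where `1 ≤ n ≤ 9` and `v = q / p`
(`mem_projPlane_or_isExceptional`). Each of them is the localization of a polynomial ring
`ℂ[s, t]` at a principal prime ideal, so that orders of functions can be read off from polynomials
(`LocalizedAt.ord_pos_iff_dvd`), and `ds ∧ dt` generates the regular 2-forms
(`LocalizedAt.ordForm_smul`). This gives `D = 3 H - E_1 - ⋯ - E_9 = -div (dq ∧ dp)`
(`D_apply`, `ordForm_smul_wedge`). Since every 2-form is a multiple of `dq ∧ dp`, it remains to study
the functions `f` with `div f + D ≥ 0`.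

Such a function has no poles on the affine plane and at most a triple pole at infinity, so that it
is a polynomial of degree at most three in `q` and `p`. With `u₀ = 1 / p` the function `u₀³ f` is a
polynomial of degree at most three in `u₀` and `v`. The centres of the blow-ups mean that
`u₀ = 4 v³ - 16 g₂ v⁷ + u₉ v⁹` along the last exceptional curve, and `f` has no pole there if and
only if `u₀³ f` is divisible by `v⁹`. Comparison of the coefficients of `1, v, …, v⁸` leaves only the
combinations of `u₀³` and `u₀ - 4 v³ + g₂ u₀² v`, that is, of `f = 1` and
`f = p² - 4 q³ + g₂ q` (`exists_eq_of_mem_globalSections`).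

Conversely, `p² - 4 q³ + g₂ q + g₃` has order exactly `n - 3 min (n, 3)` along the `n`-th
exceptional curve (`IsExceptional.ord_weierstrass`). Adding `D` yields the coefficient zero, so the
corresponding divisor is the strict transform of the Weierstrass cubic (`weierstrassStrict_eq`),
while the section `1` yields `D`. The coordinates of a section with respect to the two generators
are the homogeneous coordinates on `|-K_S| ≅ ℙ¹`; two proportional sections have the same divisor,
and conversely because a function without zeros and poles on the affine plane is constant
(`exists_smul_of_pencilMember_eq`).
-/

noncomputable section

namespace AutP1

open MvPolynomial

/-! ### Coordinate pairs of the plane -/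

/-- A pair of rational functions that generates the function field `ℂ(q, p)`; such a pair identifies
`Spec ℂ[s, t]` with an affine plane birational to `ℙ²`. -/
def IsCoordPair (s t : K) : Prop := IntermediateField.adjoin ℂ (Set.range ![s, t]) = ⊤

/-- Evaluation of polynomials in two variables at a pair of rational functions. -/
def ev (s t : K) : MvPolynomial (Fin 2) ℂ →ₐ[ℂ] K := aeval ![s, t]

@[simp] lemma ev_X_zero (s t : K) : ev s t (X 0) = s := by simp [ev]

@[simp] lemma ev_X_one (s t : K) : ev s t (X 1) = t := by simp [ev]

@[simp] lemma ev_C (s t : K) (c : ℂ) : ev s t (C c) = algebraMap ℂ K c := by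
  simp [ev]

lemma ev_range (s t : K) : (ev s t).range = Algebra.adjoin ℂ {s, t} := by
  rw [ev, ← Algebra.adjoin_range_eq_range_aeval, Matrix.range_cons, Matrix.range_cons,
    Matrix.range_empty, Set.union_empty, Set.singleton_union]

lemma mem_adjoin_pair {s t x : K} :
    x ∈ Algebra.adjoin ℂ {s, t} ↔ ∃ a, ev s t a = x := by
  rw [← ev_range]
  rfl

lemma ev_q_p (a : MvPolynomial (Fin 2) ℂ) :
    ev q p a = algebraMap (MvPolynomial (Fin 2) ℂ) K a := by
  have : ev q p = IsScalarTower.toAlgHom ℂ (MvPolynomial (Fin 2) ℂ) K := by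
    ext i
    fin_cases i <;> simp [ev, q, p]
  rw [this]
  rfl

/-- A pair that generates a coordinate pair is itself a coordinate pair. -/
lemma IsCoordPair.of_mem {s t s' t' : K} (h : IsCoordPair s t)
    (hs : s ∈ IntermediateField.adjoin ℂ (Set.range ![s', t']))
    (ht : t ∈ IntermediateField.adjoin ℂ (Set.range ![s', t'])) : IsCoordPair s' t' := by
  rw [IsCoordPair, eq_top_iff, ← h, IntermediateField.adjoin_le_iff]
  rintro x ⟨i, rfl⟩
  fin_cases i
  · exact hs
  · exact ht

lemma fst_mem_adjoin (s t : K) : s ∈ IntermediateField.adjoin ℂ (Set.range ![s, t]) :=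
  IntermediateField.subset_adjoin _ _ ⟨0, rfl⟩

lemma snd_mem_adjoin (s t : K) : t ∈ IntermediateField.adjoin ℂ (Set.range ![s, t]) :=
  IntermediateField.subset_adjoin _ _ ⟨1, rfl⟩

lemma IsCoordPair.exists_eq_div {s t : K} (h : IsCoordPair s t) (x : K) :
    ∃ a b, ev s t b ≠ 0 ∧ x = ev s t a / ev s t b := by
  have hx : x ∈ IntermediateField.adjoin ℂ (Set.range ![s, t]) := by
    rw [h]
    trivial
  obtain ⟨a, b, rfl⟩ := (IntermediateField.mem_adjoin_range_iff ℂ _ _).1 hx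
  -- the quotient is zero by convention if the denominator vanishes at `(s, t)`
  by_cases hb : ev s t b = 0
  · refine ⟨0, 1, by simp, ?_⟩
    change ev s t a / ev s t b = _
    simp [hb]
  · exact ⟨a, b, hb, rfl⟩

lemma isCoordPair_q_p : IsCoordPair q p := by
  rw [IsCoordPair, eq_top_iff]
  intro x _
  obtain ⟨a, b, hb, rfl⟩ := IsFractionRing.div_surjective (MvPolynomial (Fin 2) ℂ) x
  rw [← ev_q_p, ← ev_q_p]
  exact (IntermediateField.mem_adjoin_range_iff ℂ _ _).2 ⟨a, b, rfl⟩

/-- Two rational functions that generate `ℂ(q, p)` are algebraically independent, because the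
transcendence degree is two. -/
lemma IsCoordPair.ev_injective {s t : K} (h : IsCoordPair s t) :
    Function.Injective (ev s t) := by
  have hq : AlgebraicIndependent ℂ ![q, p] := by
    change Function.Injective (ev q p)
    intro a b hab
    rw [ev_q_p, ev_q_p] at hab
    exact IsFractionRing.injective (MvPolynomial (Fin 2) ℂ) K hab
  have hle : Cardinal.mk (Fin 2) ≤ Algebra.trdeg ℂ K := hq.cardinalMk_le_trdeg
  have halg : Algebra.IsAlgebraic (Algebra.adjoin ℂ (Set.range ![s, t])) K := by
    refine ⟨fun x => ?_⟩
    obtain ⟨a, b, hb, rfl⟩ := h.exists_eq_div x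
    have hmem (c) : ev s t c ∈ Algebra.adjoin ℂ (Set.range ![s, t]) := by
      rw [Algebra.adjoin_range_eq_range_aeval]
      exact ⟨c, rfl⟩
    rw [div_eq_mul_inv]
    exact (isAlgebraic_algebraMap (⟨_, hmem a⟩ : Algebra.adjoin ℂ (Set.range ![s, t]))).mul
      (isAlgebraic_algebraMap (⟨_, hmem b⟩ : Algebra.adjoin ℂ (Set.range ![s, t]))).inv
  exact (Algebra.IsAlgebraic.isTranscendenceBasis_of_le_trdeg_of_finite ℂ ![s, t] hle).1

lemma IsCoordPair.ev_eq_zero_iff {s t : K} (h : IsCoordPair s t) {a : MvPolynomial (Fin 2) ℂ} :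
    ev s t a = 0 ↔ a = 0 := map_eq_zero_iff _ h.ev_injective

lemma IsCoordPair.snd_ne_zero {s t : K} (h : IsCoordPair s t) : t ≠ 0 := by
  rw [← ev_X_one s t, Ne, h.ev_eq_zero_iff]
  exact X_ne_zero 1

lemma IsCoordPair.fst_sub_ne_zero {s t : K} (h : IsCoordPair s t) (c : ℂ) :
    s - algebraMap ℂ K c ≠ 0 := by
  rw [← ev_X_zero s t, ← ev_C s t, ← map_sub, Ne, h.ev_eq_zero_iff]
  intro h0
  have := congrArg (eval ![c + 1, 0]) h0
  simp at this

lemma IsCoordPair.fst_ne_zero {s t : K} (h : IsCoordPair s t) : s ≠ 0 := by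
  simpa using h.fst_sub_ne_zero 0

/-! ### Orders along prime divisors -/

section Order

variable {M : Set (LocalSubring K)} (V : PrimeDivisor M)

@[simp] lemma PrimeDivisor.ord_zero : V.ord 0 = 0 := by simp [PrimeDivisor.ord]

@[simp] lemma PrimeDivisor.ord_one : V.ord 1 = 0 := by simp [PrimeDivisor.ord]

@[simp] lemma PrimeDivisor.ord_inv (f : K) : V.ord f⁻¹ = -V.ord f := by
  simp [PrimeDivisor.ord, WithZero.log_inv]

lemma PrimeDivisor.ord_div {f g : K} (hf : f ≠ 0) (hg : g ≠ 0) :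
    V.ord (f / g) = V.ord f - V.ord g := by
  rw [div_eq_mul_inv, V.ord_mul hf (inv_ne_zero hg), V.ord_inv, sub_eq_add_neg]

@[simp] lemma PrimeDivisor.ord_neg (f : K) : V.ord (-f) = V.ord f := by
  simp [PrimeDivisor.ord, Valuation.map_neg]

lemma PrimeDivisor.ord_nonneg_iff {f : K} (hf : f ≠ 0) : 0 ≤ V.ord f ↔ f ∈ V.ring := by
  have h1 : 0 ≤ V.ord f ↔
      (IsDiscreteValuationRing.maximalIdeal V.ring).valuation K f ≤ 1 := by
    rw [PrimeDivisor.ord, neg_nonneg, ← WithZero.log_one,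
      WithZero.log_le_log (by simpa using hf) one_ne_zero]
  rw [h1]
  constructor
  · intro h
    obtain ⟨a, ha⟩ := IsDiscreteValuationRing.exists_lift_of_le_one h
    exact ha ▸ a.2
  · intro h
    exact IsDedekindDomain.HeightOneSpectrum.valuation_le_one
      (IsDiscreteValuationRing.maximalIdeal V.ring) (⟨f, h⟩ : V.ring)

lemma PrimeDivisor.ord_nonneg {f : K} (hf : f ∈ V.ring) : 0 ≤ V.ord f := by
  by_cases h : f = 0
  · simp [h]
  · exact (V.ord_nonneg_iff h).2 hf

lemma PrimeDivisor.ord_pos_iff {f : K} (hf : f ≠ 0) : 0 < V.ord f ↔ f⁻¹ ∉ V.ring := by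
  rw [← V.ord_nonneg_iff (inv_ne_zero hf), V.ord_inv]
  simp

lemma PrimeDivisor.algebraMap_mem (c : ℂ) : algebraMap ℂ K c ∈ V.ring := by
  by_cases hc : c = 0
  · simp [hc, V.ring.zero_mem]
  · exact (V.ord_nonneg_iff (by simpa using hc)).1 (V.ord_algebraMap c).ge

/-- The case `f = 0` is separate because `0⁻¹ = 0` is an element of `A`. -/
lemma mem_maximalIdeal_iff {A : ValuationSubring K} {f : K}
    (hf : f ∈ A.toLocalSubring.toSubring) :
    (⟨f, hf⟩ : A.toLocalSubring.toSubring) ∈ IsLocalRing.maximalIdeal A.toLocalSubring.toSubring ↔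
      f = 0 ∨ f⁻¹ ∉ A := by
  have : (⟨f, hf⟩ : A.toLocalSubring.toSubring) ∈ IsLocalRing.maximalIdeal A.toLocalSubring.toSubring ↔
      ¬ IsUnit (⟨f, hf⟩ : A.toLocalSubring.toSubring) := IsLocalRing.mem_maximalIdeal _
  rw [this, ← not_iff_not, not_not, not_or, not_not]
  constructor
  · intro h
    obtain ⟨g, hg⟩ := isUnit_iff_exists_inv.1 h
    have hg' : f * g = 1 := congrArg Subtype.val hg
    have h0 : f ≠ 0 := left_ne_zero_of_mul_eq_one hg'
    exact ⟨h0, (eq_inv_of_mul_eq_one_right hg') ▸ g.2⟩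
  · rintro ⟨h0, h⟩
    exact isUnit_iff_exists_inv.2 ⟨⟨f⁻¹, h⟩, Subtype.ext (mul_inv_cancel₀ h0)⟩

lemma vanishesAt_iff {f : K} (hf : f ≠ 0) :
    VanishesAt f V.ring.toLocalSubring ↔ 0 < V.ord f := by
  rw [VanishesAt]
  constructor
  · rintro ⟨h, h'⟩
    exact (V.ord_pos_iff hf).2 (((mem_maximalIdeal_iff h).1 h').resolve_left hf)
  · intro h
    have hm : f ∈ V.ring := (V.ord_nonneg_iff hf).1 h.le
    exact ⟨hm, (mem_maximalIdeal_iff hm).2 (Or.inr ((V.ord_pos_iff hf).1 h))⟩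

/-- A function of least positive order has order one, because the order is normalized. -/
lemma PrimeDivisor.ord_eq_one {t : K} (ht : 0 < V.ord t)
    (h : ∀ f, f ≠ 0 → 0 < V.ord f → V.ord t ≤ V.ord f) : V.ord t = 1 := by
  obtain ⟨π, hπ⟩ := (IsDiscreteValuationRing.maximalIdeal V.ring).valuation_exists_uniformizer K
  have h1 : V.ord π = 1 := by
    simp [PrimeDivisor.ord, hπ]
  have h0 : π ≠ 0 := by
    rintro rfl
    simp at h1
  have := h π h0 (by omega)
  omega

/-- Adding a term of larger order does not change the order. -/
lemma PrimeDivisor.ord_add_eq_left {f g : K} (hf : f ≠ 0) (hg : g ≠ 0 → V.ord f < V.ord g) :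
    V.ord (f + g) = V.ord f := by
  by_cases hg0 : g = 0
  · simp [hg0]
  have hlt := hg hg0
  have hfg : f + g ≠ 0 := by
    intro h
    have : f = -g := eq_neg_of_add_eq_zero_left h
    rw [this, V.ord_neg] at hlt
    exact lt_irrefl _ hlt
  have h1 := V.le_ord_add hf hg0 hfg
  have h2 := V.le_ord_add hfg (neg_ne_zero.2 hg0) (by simpa using hf)
  rw [add_neg_cancel_right, V.ord_neg] at h2
  rcases min_le_iff.1 h1 with h1 | h1 <;> rcases min_le_iff.1 h2 with h2 | h2 <;> omega

end Order

/-! ### Localizations of polynomial rings -/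

/-- `A` is a localization of `ℂ[s, t]` at a prime ideal: it contains `s` and `t`, and each element
of `A` is a fraction of elements of `ℂ[s, t]` whose denominator is a unit of `A`. -/
structure LocalizedAt (A : ValuationSubring K) (s t : K) : Prop where
  ev_mem : ∀ a, ev s t a ∈ A
  exists_div : ∀ x ∈ A, ∃ a b, ev s t b ≠ 0 ∧ (ev s t b)⁻¹ ∈ A ∧ x = ev s t a / ev s t b

lemma LocalizedAt.fst_mem {A : ValuationSubring K} {s t : K} (h : LocalizedAt A s t) : s ∈ A := by
  simpa using h.ev_mem (X 0)

lemma LocalizedAt.snd_mem {A : ValuationSubring K} {s t : K} (h : LocalizedAt A s t) : t ∈ A := by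
  simpa using h.ev_mem (X 1)

lemma mem_ofPrime_iff {A : Subring K} (P : Ideal A) [P.IsPrime] {x : K} :
    x ∈ (LocalSubring.ofPrime A P).toSubring ↔ ∃ a b : A, b ∉ P ∧ x = a / b := by
  constructor
  · rintro ⟨y, rfl⟩
    obtain ⟨⟨a, b⟩, rfl⟩ := IsLocalization.mk'_surjective P.primeCompl y
    refine ⟨a, b, b.2, ?_⟩
    have hb : ((b : A) : K) ≠ 0 := by
      intro h
      exact b.2 ((Subtype.ext h : (b : A) = 0) ▸ P.zero_mem)
    rw [eq_div_iff hb]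
    have := IsLocalization.lift_mk'_spec (M := P.primeCompl) (S := Localization.AtPrime P)
      (g := A.subtype) (by
        intro y
        refine IsUnit.mk0 _ fun h => y.2 ((Subtype.ext h : (y : A) = 0) ▸ P.zero_mem))
      a ((IsLocalization.lift (M := P.primeCompl) (S := Localization.AtPrime P)
        (g := A.subtype) (by
        intro y
        refine IsUnit.mk0 _ fun h => y.2 ((Subtype.ext h : (y : A) = 0) ▸ P.zero_mem)))
          (IsLocalization.mk' _ a b)) b
    rw [mul_comm]
    exact (this.1 rfl).symm
  · rintro ⟨a, b, hb, rfl⟩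
    have hb0 : ((b : A) : K) ≠ 0 := by
      intro h
      exact hb ((Subtype.ext h : (b : A) = 0) ▸ P.zero_mem)
    refine ⟨IsLocalization.mk' (Localization.AtPrime P) a (⟨b, hb⟩ : P.primeCompl), ?_⟩
    rw [eq_div_iff hb0, mul_comm]
    exact ((IsLocalization.lift_mk'_spec _ _ _ _).1 rfl).symm

/-- For valuation rings, the points of the affine plane with coordinates `s` and `t` are described
by `LocalizedAt`; the prime ideal is recovered as the trace of the maximal ideal. -/
lemma mem_affineModel_iff {A : ValuationSubring K} {s t : K} :
    A.toLocalSubring ∈ affineModel {s, t} ↔ LocalizedAt A s t := by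
  constructor
  · rintro ⟨P, hP, h⟩
    have hmem (x : K) : x ∈ A ↔
        ∃ a b : (Algebra.adjoin ℂ {s, t}).toSubring, b ∉ P ∧ x = a / b := by
      rw [← mem_ofPrime_iff P, ← h]
      rfl
    have h1 : (1 : (Algebra.adjoin ℂ {s, t}).toSubring) ∉ P :=
      fun h => hP.ne_top (P.eq_top_of_unit_mem 1 1 h (one_mul 1))
    refine ⟨fun a => ?_, fun x hx => ?_⟩
    · exact (hmem _).2 ⟨⟨ev s t a, mem_adjoin_pair.2 ⟨a, rfl⟩⟩, 1, h1, by simp⟩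
    · obtain ⟨a, b, hb, rfl⟩ := (hmem x).1 hx
      obtain ⟨a', ha'⟩ := mem_adjoin_pair.1 a.2
      obtain ⟨b', hb'⟩ := mem_adjoin_pair.1 b.2
      refine ⟨a', b', ?_, ?_, by rw [ha', hb']⟩
      · rw [hb']
        intro h
        exact hb ((Subtype.ext h : b = 0) ▸ P.zero_mem)
      · rw [hb']
        exact (hmem _).2 ⟨1, b, hb, by simp⟩
  · intro h
    have hle : (Algebra.adjoin ℂ {s, t}).toSubring ≤ A.toSubring := by
      intro x hx
      obtain ⟨a, rfl⟩ := mem_adjoin_pair.1 hx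
      exact h.ev_mem a
    let P := (IsLocalRing.maximalIdeal A.toLocalSubring.toSubring).comap (Subring.inclusion hle)
    have hP : P.IsPrime := Ideal.comap_isPrime _ _
    have hPmem (b : (Algebra.adjoin ℂ {s, t}).toSubring) : b ∈ P ↔ (b : K) = 0 ∨ (b : K)⁻¹ ∉ A :=
      mem_maximalIdeal_iff (hle b.2)
    refine ⟨P, hP, LocalSubring.toSubring_injective ?_⟩
    ext x
    rw [mem_ofPrime_iff P]
    constructor
    · intro hx
      obtain ⟨a, b, hb0, hb, rfl⟩ := h.exists_div x hx
      refine ⟨⟨ev s t a, mem_adjoin_pair.2 ⟨a, rfl⟩⟩, ⟨ev s t b, mem_adjoin_pair.2 ⟨b, rfl⟩⟩,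
        ?_, rfl⟩
      rw [hPmem]
      simp [hb0, hb]
    · rintro ⟨a, b, hb, rfl⟩
      rw [hPmem] at hb
      push Not at hb
      rw [div_eq_mul_inv]
      exact A.mul_mem _ _ (hle a.2) hb.2

/-! ### Prime divisors of an affine plane -/

section Chart

variable {M : Set (LocalSubring K)} {V : PrimeDivisor M} {s t : K}

lemma IsCoordPair.ev_ne_zero (h : IsCoordPair s t) {a : MvPolynomial (Fin 2) ℂ} (ha : a ≠ 0) :
    ev s t a ≠ 0 := h.ev_eq_zero_iff.not.2 ha

lemma LocalizedAt.exists_div_ord (hV : LocalizedAt V.ring s t) {x : K} (hx : x ∈ V.ring) :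
    ∃ a b, ev s t b ≠ 0 ∧ V.ord (ev s t b) = 0 ∧ x = ev s t a / ev s t b := by
  obtain ⟨a, b, hb0, hb, rfl⟩ := hV.exists_div x hx
  refine ⟨a, b, hb0, le_antisymm ?_ (V.ord_nonneg (hV.ev_mem b)), rfl⟩
  have := V.ord_nonneg hb
  rw [V.ord_inv] at this
  omega

/-- The localization of `ℂ[s, t]` at the centre of a discrete valuation ring has dimension one:
the centre is generated by any prime element that it contains. -/
lemma LocalizedAt.ord_pos_iff_dvd (hV : LocalizedAt V.ring s t) (h : IsCoordPair s t)
    {π : MvPolynomial (Fin 2) ℂ} (hπ : Prime π) (hpos : 0 < V.ord (ev s t π))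
    {a : MvPolynomial (Fin 2) ℂ} (ha : a ≠ 0) : 0 < V.ord (ev s t a) ↔ π ∣ a := by
  have hmul {b : MvPolynomial (Fin 2) ℂ} (hb : b ≠ 0) (hdvd : ∃ c d, b = c * d ∧
      0 < V.ord (ev s t c)) : 0 < V.ord (ev s t b) := by
    obtain ⟨c, d, rfl, hc⟩ := hdvd
    obtain ⟨hc0, hd0⟩ := mul_ne_zero_iff.1 hb
    rw [map_mul, V.ord_mul (h.ev_ne_zero hc0) (h.ev_ne_zero hd0)]
    have := V.ord_nonneg (hV.ev_mem d)
    omega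
  constructor
  · intro hapos
    have hπ0 := h.ev_ne_zero hπ.ne_zero
    have ha0 := h.ev_ne_zero ha
    rcases V.ring.mem_or_inv_mem (ev s t a / ev s t π) with hx | hx
    · obtain ⟨c, d, hd0, hd, hx⟩ := hV.exists_div_ord hx
      rw [div_eq_div_iff hπ0 hd0, ← map_mul, ← map_mul] at hx
      have hx := h.ev_injective hx
      rcases hπ.dvd_or_dvd (Dvd.intro_left c hx.symm : π ∣ a * d) with hd' | ⟨e, rfl⟩
      · exact hd'
      · have := hmul (by rintro h0; simp [h0] at hd0) ⟨π, e, rfl, hpos⟩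
        omega
    · rw [inv_div] at hx
      obtain ⟨c, d, hd0, hd, hx⟩ := hV.exists_div_ord hx
      rw [div_eq_div_iff ha0 hd0, ← map_mul, ← map_mul] at hx
      have hx := h.ev_injective hx
      rcases hπ.dvd_or_dvd (Dvd.intro d hx : π ∣ c * a) with ⟨e, rfl⟩ | ha'
      · have hde : d = a * e := by
          apply mul_left_cancel₀ hπ.ne_zero
          rw [hx]
          ring
        have := hmul (b := d) (by rintro rfl; simp at hd0) ⟨a, e, hde, hapos⟩
        omega
      · exact ha'
  · rintro ⟨e, rfl⟩
    exact hmul ha ⟨π, e, rfl, hpos⟩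

/-- A prime element in the centre of a prime divisor is a uniformizer. -/
lemma LocalizedAt.ord_prime (hV : LocalizedAt V.ring s t) (h : IsCoordPair s t)
    {π : MvPolynomial (Fin 2) ℂ} (hπ : Prime π) (hpos : 0 < V.ord (ev s t π)) :
    V.ord (ev s t π) = 1 := by
  refine V.ord_eq_one hpos fun f hf hfpos => ?_
  obtain ⟨a, b, hb0, hb, rfl⟩ := hV.exists_div_ord ((V.ord_nonneg_iff hf).1 hfpos.le)
  have ha0 : ev s t a ≠ 0 := by
    rintro h0
    simp [h0] at hf
  rw [V.ord_div ha0 hb0, hb, sub_zero] at hfpos ⊢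
  have ha : a ≠ 0 := by
    rintro rfl
    simp at ha0
  obtain ⟨c, rfl⟩ := (hV.ord_pos_iff_dvd h hπ hpos ha).1 hfpos
  obtain ⟨-, hc⟩ := mul_ne_zero_iff.1 ha
  rw [map_mul, V.ord_mul (h.ev_ne_zero hπ.ne_zero) (h.ev_ne_zero hc)]
  have := V.ord_nonneg (hV.ev_mem c)
  omega

lemma PrimeDivisor.ext_ring {V W : PrimeDivisor M} (h : V.ring = W.ring) : V = W := by
  cases V
  cases W
  subst h
  rfl

/-- A prime divisor of an affine plane is determined by a prime element in its centre. -/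
lemma LocalizedAt.subsingleton (h : IsCoordPair s t) {π : MvPolynomial (Fin 2) ℂ} (hπ : Prime π) :
    {V : PrimeDivisor M | LocalizedAt V.ring s t ∧ 0 < V.ord (ev s t π)}.Subsingleton := by
  have key {V W : PrimeDivisor M} (hV : LocalizedAt V.ring s t) (hVpos : 0 < V.ord (ev s t π))
      (hW : LocalizedAt W.ring s t) (hWpos : 0 < W.ord (ev s t π)) {x : K} (hx : x ∈ V.ring) :
      x ∈ W.ring := by
    obtain ⟨a, b, hb0, hb, rfl⟩ := hV.exists_div_ord hx
    have hb' : b ≠ 0 := by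
      rintro rfl
      simp at hb0
    have h1 := (hV.ord_pos_iff_dvd h hπ hVpos hb').not.1 (by omega)
    have h2 := (hW.ord_pos_iff_dvd h hπ hWpos hb').not.2 h1
    rw [W.ord_pos_iff hb0, not_not] at h2
    rw [div_eq_mul_inv]
    exact W.ring.mul_mem _ _ (hW.ev_mem a) h2
  rintro V ⟨hV, hVpos⟩ W ⟨hW, hWpos⟩
  refine PrimeDivisor.ext_ring (ValuationSubring.ext _ _ fun x => ?_)
  exact ⟨key hV hVpos hW hWpos, key hW hWpos hV hVpos⟩

/-- A nonzero rational function has only finitely many zeros and poles on an affine plane. -/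
lemma LocalizedAt.finite_ord_ne_zero (h : IsCoordPair s t) (g : K) :
    {V : PrimeDivisor M | LocalizedAt V.ring s t ∧ V.ord g ≠ 0}.Finite := by
  by_cases hg : g = 0
  · simp [hg]
  obtain ⟨a, b, hb0, rfl⟩ := h.exists_eq_div g
  have ha0 : ev s t a ≠ 0 := by
    rintro h0
    simp [h0] at hg
  have hab : a * b ≠ 0 := by
    rintro h0
    have := congrArg (ev s t) h0
    simp [ha0, hb0] at this
  refine Set.Finite.subset ((UniqueFactorizationMonoid.factors (a * b)).toFinset.finite_toSet.biUnion
    (t := fun π => {V : PrimeDivisor M | Prime π ∧ LocalizedAt V.ring s t ∧ 0 < V.ord (ev s t π)})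
    fun π _ => Set.Subsingleton.finite ?_) ?_
  · rintro V ⟨hπ, hV⟩ W ⟨-, hW⟩
    exact LocalizedAt.subsingleton h hπ hV hW
  · rintro V ⟨hV, hVg⟩
    have hpos : 0 < V.ord (ev s t (a * b)) := by
      rw [map_mul, V.ord_mul ha0 hb0]
      rw [V.ord_div ha0 hb0] at hVg
      have h1 := V.ord_nonneg (hV.ev_mem a)
      have h2 := V.ord_nonneg (hV.ev_mem b)
      omega
    by_contra hcon
    simp only [Set.mem_iUnion, not_exists] at hcon
    obtain ⟨w, hw⟩ := UniqueFactorizationMonoid.factors_prod hab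
    -- otherwise all prime factors, and hence the product, are units
    have hprod : ∀ m : Multiset (MvPolynomial (Fin 2) ℂ),
        (∀ π ∈ m, π ∈ UniqueFactorizationMonoid.factors (a * b)) → V.ord (ev s t m.prod) = 0 := by
      intro m
      induction m using Multiset.induction_on with
      | empty => simp
      | cons π m ih =>
        intro hm
        have hπ := UniqueFactorizationMonoid.prime_of_factor π (hm π (Multiset.mem_cons_self π m))
        have hm0 : m.prod ≠ 0 := Multiset.prod_ne_zero fun h0 => by
          have := UniqueFactorizationMonoid.prime_of_factor 0 (hm 0 (Multiset.mem_cons_of_mem h0))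
          exact this.ne_zero rfl
        rw [Multiset.prod_cons, map_mul, V.ord_mul (h.ev_ne_zero hπ.ne_zero) (h.ev_ne_zero hm0),
          ih fun ρ hρ => hm ρ (Multiset.mem_cons_of_mem hρ), add_zero]
        refine le_antisymm (not_lt.1 fun hlt => ?_) (V.ord_nonneg (hV.ev_mem π))
        exact hcon π (by simpa using hm π (Multiset.mem_cons_self π m)) ⟨hπ, hV, hlt⟩
    have hunit : V.ord (ev s t (w : MvPolynomial (Fin 2) ℂ)) = 0 := by
      have h1 := V.ord_nonneg (hV.ev_mem w)
      have h2 := V.ord_nonneg (hV.ev_mem (↑w⁻¹ : MvPolynomial (Fin 2) ℂ))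
      have h3 : V.ord (ev s t w) + V.ord (ev s t (↑w⁻¹ : MvPolynomial (Fin 2) ℂ)) = 0 := by
        rw [← V.ord_mul (h.ev_ne_zero w.ne_zero) (h.ev_ne_zero w⁻¹.ne_zero), ← map_mul,
          Units.mul_inv, map_one, V.ord_one]
      omega
    have hp0 : (UniqueFactorizationMonoid.factors (a * b)).prod ≠ 0 := by
      intro h0
      rw [h0, zero_mul] at hw
      exact hab hw.symm
    rw [← hw, map_mul, V.ord_mul (h.ev_ne_zero hp0) (h.ev_ne_zero w.ne_zero),
      hprod _ fun π hπ => hπ, hunit] at hpos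
    exact lt_irrefl _ hpos

variable (s t) in
/-- The local ring of the affine plane `Spec ℂ[s, t]` at the generic point of the curve `π = 0`. -/
def curveRing (h : IsCoordPair s t) {π : MvPolynomial (Fin 2) ℂ} (hπ : Prime π) :
    ValuationSubring K where
  carrier := {x | ∃ a b, ¬ π ∣ b ∧ x = ev s t a / ev s t b}
  zero_mem' := ⟨0, 1, hπ.not_dvd_one, by simp⟩
  one_mem' := ⟨1, 1, hπ.not_dvd_one, by simp⟩
  add_mem' := by
    rintro _ _ ⟨a, b, hb, rfl⟩ ⟨c, d, hd, rfl⟩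
    refine ⟨a * d + b * c, b * d, fun hbd => (hπ.dvd_or_dvd hbd).elim hb hd, ?_⟩
    rw [div_add_div]
    · simp
    · exact h.ev_ne_zero (by rintro rfl; simp at hb)
    · exact h.ev_ne_zero (by rintro rfl; simp at hd)
  mul_mem' := by
    rintro _ _ ⟨a, b, hb, rfl⟩ ⟨c, d, hd, rfl⟩
    refine ⟨a * c, b * d, fun hbd => (hπ.dvd_or_dvd hbd).elim hb hd, ?_⟩
    rw [div_mul_div_comm, map_mul, map_mul]
  neg_mem' := by
    rintro _ ⟨a, b, hb, rfl⟩
    exact ⟨-a, b, hb, by rw [map_neg, ← neg_div]⟩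
  mem_or_inv_mem' := by
    intro x
    obtain ⟨a, b, hb0, rfl⟩ := h.exists_eq_div x
    by_cases ha : a = 0
    · exact Or.inl ⟨0, 1, hπ.not_dvd_one, by simp [ha]⟩
    obtain ⟨a', b', c, hrel, rfl, rfl⟩ := UniqueFactorizationMonoid.exists_reduced_factors a ha b
    have hc : ev s t c ≠ 0 := by
      intro h0
      simp [h0] at hb0
    by_cases hb' : π ∣ b'
    · refine Or.inr ⟨b', a', fun ha' => hπ.not_isUnit (hrel ha' hb'), ?_⟩
      rw [map_mul, map_mul, mul_div_mul_left _ _ hc, inv_div]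
    · exact Or.inl ⟨a', b', hb', by rw [map_mul, map_mul, mul_div_mul_left _ _ hc]⟩

lemma curveRing_localizedAt (h : IsCoordPair s t) {π : MvPolynomial (Fin 2) ℂ} (hπ : Prime π) :
    LocalizedAt (curveRing s t h hπ) s t where
  ev_mem a := ⟨a, 1, hπ.not_dvd_one, by simp⟩
  exists_div := by
    rintro _ ⟨a, b, hb, rfl⟩
    exact ⟨a, b, h.ev_ne_zero (by rintro rfl; simp at hb), ⟨1, b, hb, by simp⟩, rfl⟩

lemma inv_notMem_curveRing (h : IsCoordPair s t) {π : MvPolynomial (Fin 2) ℂ} (hπ : Prime π) :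
    (ev s t π)⁻¹ ∉ curveRing s t h hπ := by
  rintro ⟨a, b, hb, hab⟩
  have hb0 : ev s t b ≠ 0 := h.ev_ne_zero (by rintro rfl; simp at hb)
  rw [inv_eq_one_div, div_eq_div_iff (h.ev_ne_zero hπ.ne_zero) hb0, one_mul, ← map_mul] at hab
  exact hb (Dvd.intro_left a (h.ev_injective hab).symm)

lemma curveRing_isDiscreteValuationRing (h : IsCoordPair s t) {π : MvPolynomial (Fin 2) ℂ}
    (hπ : Prime π) : IsDiscreteValuationRing (curveRing s t h hπ) := by
  have hunit {b : MvPolynomial (Fin 2) ℂ} (hb : ¬ π ∣ b) :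
      IsUnit (⟨ev s t b, (curveRing_localizedAt h hπ).ev_mem b⟩ : curveRing s t h hπ) := by
    have hb0 : ev s t b ≠ 0 := h.ev_ne_zero (by rintro rfl; simp at hb)
    exact isUnit_iff_exists_inv.2 ⟨⟨(ev s t b)⁻¹, 1, b, hb, by simp⟩,
      Subtype.ext (mul_inv_cancel₀ hb0)⟩
  let ϖ : curveRing s t h hπ := ⟨ev s t π, (curveRing_localizedAt h hπ).ev_mem π⟩
  have hϖ0 : ϖ ≠ 0 := fun h0 => h.ev_ne_zero hπ.ne_zero (congrArg Subtype.val h0)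
  have hϖ : ¬ IsUnit ϖ := by
    intro hu
    obtain ⟨g, hg⟩ := isUnit_iff_exists_inv.1 hu
    have hg' : ev s t π * g = 1 := congrArg Subtype.val hg
    exact inv_notMem_curveRing h hπ (eq_inv_of_mul_eq_one_right hg' ▸ g.2)
  have hfac {x : curveRing s t h hπ} (hx : x ≠ 0) : ∃ n, Associated (ϖ ^ n) x := by
    obtain ⟨x, a, b, hb, rfl⟩ := x
    have ha : a ≠ 0 := by
      rintro rfl
      exact hx (Subtype.ext (by simp))
    obtain ⟨c, hac, hc⟩ := (FiniteMultiplicity.of_prime_left hπ ha).exists_eq_pow_mul_and_not_dvd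
    have hb0 : ev s t b ≠ 0 := h.ev_ne_zero (by rintro rfl; simp at hb)
    refine ⟨multiplicity π a, (((hunit hc).unit : (curveRing s t h hπ)ˣ) / (hunit hb).unit), ?_⟩
    rw [← Units.mul_left_inj (hunit hb).unit, mul_assoc, ← Units.val_mul, div_mul_cancel]
    refine Subtype.ext ?_
    change ev s t π ^ multiplicity π a * ev s t c = ev s t a / ev s t b * ev s t b
    rw [div_mul_cancel₀ _ hb0, ← map_pow, ← map_mul, ← hac]
  refine IsDiscreteValuationRing.ofHasUnitMulPowIrreducibleFactorization ⟨ϖ, ?_, hfac⟩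
  refine ⟨hϖ, fun {x y} hxy => ?_⟩
  have hx0 : x ≠ 0 := fun h0 => hϖ0 (by rw [hxy, h0, zero_mul])
  have hy0 : y ≠ 0 := fun h0 => hϖ0 (by rw [hxy, h0, mul_zero])
  obtain ⟨n, u, rfl⟩ := hfac hx0
  obtain ⟨m, w, rfl⟩ := hfac hy0
  rcases n with _ | n
  · left
    simp
  rcases m with _ | m
  · right
    simp
  exfalso
  apply hϖ
  refine isUnit_iff_exists_inv.2 ⟨ϖ ^ n * u * (ϖ ^ m * w), ?_⟩
  apply mul_left_cancel₀ hϖ0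
  rw [mul_one]
  refine Eq.trans ?_ hxy.symm
  ring

/-- A rational function that is regular in codimension one on an affine plane is a polynomial. -/
lemma IsCoordPair.exists_eq_ev (h : IsCoordPair s t) {f : K}
    (hf : ∀ A : ValuationSubring K, IsDiscreteValuationRing A → LocalizedAt A s t → f ∈ A) :
    ∃ a, f = ev s t a := by
  obtain ⟨a, b, hb0, rfl⟩ := h.exists_eq_div f
  by_cases ha : a = 0
  · exact ⟨0, by simp [ha]⟩
  obtain ⟨a, b, c, hrel, rfl, rfl⟩ := UniqueFactorizationMonoid.exists_reduced_factors a ha b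
  rw [map_mul] at hb0
  obtain ⟨hc0, hb0⟩ := mul_ne_zero_iff.1 hb0
  rw [map_mul, map_mul, mul_div_mul_left _ _ hc0] at hf ⊢
  by_cases hb : IsUnit b
  · obtain ⟨w, rfl⟩ := hb
    refine ⟨a * ↑w⁻¹, ?_⟩
    rw [div_eq_iff hb0, ← map_mul, mul_assoc, Units.inv_mul, mul_one]
  exfalso
  obtain ⟨π, hπ, hπb⟩ := WfDvdMonoid.exists_irreducible_factor hb (by rintro rfl; simp at hb0)
  have hπ := hπ.prime
  obtain ⟨c, d, hd, hcd⟩ := hf _ (curveRing_isDiscreteValuationRing h hπ)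
    (curveRing_localizedAt h hπ)
  have hd0 : ev s t d ≠ 0 := h.ev_ne_zero (by rintro rfl; simp at hd)
  rw [div_eq_div_iff hb0 hd0, ← map_mul, ← map_mul] at hcd
  have hdvd : π ∣ a * d := (h.ev_injective hcd).symm ▸ Dvd.dvd.mul_left hπb c
  exact hπ.not_isUnit (hrel ((hπ.dvd_or_dvd hdvd).resolve_right hd) hπb)

end Chart

/-! ### Orders of rational 2-forms -/

/-- The rational 2-form `df ∧ dg`. -/
def wedge (f g : K) : TwoForm :=
  exteriorPower.ιMulti K 2 ![KaehlerDifferential.D ℂ K f, KaehlerDifferential.D ℂ K g]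

lemma alternatingMap_pair {R N P : Type*} [CommRing R] [AddCommGroup N] [Module R N]
    [AddCommGroup P] [Module R P] (φ : N [⋀^Fin 2]→ₗ[R] P) (x y : N) (α β γ δ : R) :
    φ ![α • x + β • y, γ • x + δ • y] = (α * δ - β * γ) • φ ![x, y] := by
  have hsw (z w : N) : φ ![w, z] = -φ ![z, w] := by
    have := φ.map_swap ![z, w] (i := 0) (j := 1) (by simp)
    rw [← this]
    congr 1
    ext i
    fin_cases i <;> simp
  have hl (a b : R) (z w u : N) : φ ![a • z + b • w, u] = a • φ ![z, u] + b • φ ![w, u] := by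
    rw [φ.map_vecCons_add, φ.map_vecCons_smul, φ.map_vecCons_smul]
  have hd (z : N) : φ ![z, z] = 0 := φ.map_eq_zero_of_eq _ (i := 0) (j := 1) (by simp) (by simp)
  rw [hl, hsw (γ • x + δ • y) x, hsw (γ • x + δ • y) y, hl, hl, hd, hd, hsw x y]
  module

lemma smul_add_smul_add {R N : Type*} [CommRing R] [AddCommGroup N] [Module R N] (x y : N)
    (α β γ δ : R) : (α • x + β • y) + (γ • x + δ • y) = (α + γ) • x + (β + δ) • y := by
  module

lemma smul_smul_add_smul {R N : Type*} [CommRing R] [AddCommGroup N] [Module R N] (x y : N)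
    (k α β : R) : k • (α • x + β • y) = (k * α) • x + (k * β) • y := by
  module

lemma smul_sub_smul_pair {R N : Type*} [CommRing R] [AddCommGroup N] [Module R N] (x y : N)
    (k a b α β γ δ : R) : k • (b • (α • x + β • y) - a • (γ • x + δ • y)) =
      (k * (b * α - a * γ)) • x + (k * (b * β - a * δ)) • y := by
  module

/-- The differentials of the elements of a localization of `ℂ[s, t]` are combinations of `ds` and
`dt` with coefficients in this localization. -/
lemma LocalizedAt.exists_differential {A : ValuationSubring K} {s t : K} (hA : LocalizedAt A s t)
    {f : K} (hf : f ∈ A) : ∃ α ∈ A, ∃ β ∈ A, KaehlerDifferential.D ℂ K f =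
      α • KaehlerDifferential.D ℂ K s + β • KaehlerDifferential.D ℂ K t := by
  have hpoly (a : MvPolynomial (Fin 2) ℂ) : ∃ α ∈ A, ∃ β ∈ A,
      KaehlerDifferential.D ℂ K (ev s t a) =
      α • KaehlerDifferential.D ℂ K s + β • KaehlerDifferential.D ℂ K t := by
    induction a using MvPolynomial.induction_on with
    | C c => exact ⟨0, A.zero_mem, 0, A.zero_mem, by simp⟩
    | add a b iha ihb =>
      obtain ⟨α, hα, β, hβ, ha⟩ := iha
      obtain ⟨γ, hγ, δ, hδ, hb⟩ := ihb
      refine ⟨α + γ, A.add_mem _ _ hα hγ, β + δ, A.add_mem _ _ hβ hδ, ?_⟩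
      rw [map_add, map_add, ha, hb, smul_add_smul_add]
    | mul_X a i iha =>
      obtain ⟨α, hα, β, hβ, ha⟩ := iha
      have hs := hA.fst_mem
      have ht := hA.snd_mem
      have ham := hA.ev_mem a
      fin_cases i
      · refine ⟨s * α + ev s t a, A.add_mem _ _ (A.mul_mem _ _ hs hα) ham, s * β,
          A.mul_mem _ _ hs hβ, ?_⟩
        simp only [Fin.zero_eta, map_mul, ev_X_zero, Derivation.leibniz, ha, smul_smul_add_smul]
        rw [← add_assoc, add_smul, add_comm (_ • _) ((s * α) • _)]
      · refine ⟨t * α, A.mul_mem _ _ ht hα, t * β + ev s t a,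
          A.add_mem _ _ (A.mul_mem _ _ ht hβ) ham, ?_⟩
        simp only [Fin.mk_one, map_mul, ev_X_one, Derivation.leibniz, ha, smul_smul_add_smul]
        rw [add_left_comm, add_smul, add_comm (_ • _) ((t * β) • _)]
  obtain ⟨a, b, hb0, hb, rfl⟩ := hA.exists_div f hf
  obtain ⟨α, hα, β, hβ, ha⟩ := hpoly a
  obtain ⟨γ, hγ, δ, hδ, hb'⟩ := hpoly b
  refine ⟨(ev s t b)⁻¹ ^ 2 * (ev s t b * α - ev s t a * γ), ?_,
    (ev s t b)⁻¹ ^ 2 * (ev s t b * β - ev s t a * δ), ?_, ?_⟩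
  · exact A.mul_mem _ _ (pow_mem hb 2)
      (sub_mem (A.mul_mem _ _ (hA.ev_mem b) hα) (A.mul_mem _ _ (hA.ev_mem a) hγ))
  · exact A.mul_mem _ _ (pow_mem hb 2)
      (sub_mem (A.mul_mem _ _ (hA.ev_mem b) hβ) (A.mul_mem _ _ (hA.ev_mem a) hδ))
  · rw [Derivation.leibniz_div, ha, hb', smul_sub_smul_pair]

lemma LocalizedAt.exists_wedge {A : ValuationSubring K} {s t : K} (hA : LocalizedAt A s t)
    {f g : K} (hf : f ∈ A) (hg : g ∈ A) : ∃ c ∈ A, wedge f g = c • wedge s t := by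
  obtain ⟨α, hα, β, hβ, hf'⟩ := hA.exists_differential hf
  obtain ⟨γ, hγ, δ, hδ, hg'⟩ := hA.exists_differential hg
  refine ⟨α * δ - β * γ, sub_mem (A.mul_mem _ _ hα hδ) (A.mul_mem _ _ hβ hγ), ?_⟩
  rw [wedge, hf', hg', alternatingMap_pair, wedge]

lemma IsCoordPair.localizedAt_top {s t : K} (h : IsCoordPair s t) : LocalizedAt ⊤ s t where
  ev_mem _ := ValuationSubring.mem_top _
  exists_div x _ := by
    obtain ⟨a, b, hb, hx⟩ := h.exists_eq_div x
    exact ⟨a, b, hb, ValuationSubring.mem_top _, hx⟩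

/-- The 2-forms on the plane form a vector space of dimension at most one over `ℂ(q, p)`. -/
lemma IsCoordPair.exists_eq_smul_wedge {s t : K} (h : IsCoordPair s t) (η : TwoForm) :
    ∃ c : K, η = c • wedge s t := by
  have hη : η ∈ Submodule.span K (exteriorPower.ιMulti K 2 ''
      {a | Set.range a ⊆ Set.range (KaehlerDifferential.D ℂ K)}) := by
    rw [exteriorPower.ιMulti_span_of_span K 2 _ (KaehlerDifferential.span_range_derivation ℂ K)]
    trivial
  induction hη using Submodule.span_induction with
  | mem x hx =>
    obtain ⟨a, ha, rfl⟩ := hx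
    obtain ⟨f, hf⟩ := ha ⟨0, rfl⟩
    obtain ⟨g, hg⟩ := ha ⟨1, rfl⟩
    obtain ⟨c, -, hc⟩ := h.localizedAt_top.exists_wedge (f := f) (g := g)
      (ValuationSubring.mem_top _) (ValuationSubring.mem_top _)
    refine ⟨c, ?_⟩
    rw [← hc, wedge, hf, hg]
    congr 1
    ext i
    fin_cases i <;> rfl
  | zero => exact ⟨0, by simp⟩
  | add x y _ _ hx hy =>
    obtain ⟨c, rfl⟩ := hx
    obtain ⟨d, rfl⟩ := hy
    exact ⟨c + d, by rw [add_smul]⟩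
  | smul k x _ hx =>
    obtain ⟨c, rfl⟩ := hx
    exact ⟨k * c, by rw [smul_smul]⟩

/-- On a plane with coordinates `s` and `t`, the form `ds ∧ dt` generates the regular 2-forms. -/
lemma LocalizedAt.ordForm_smul {M : Set (LocalSubring K)} {V : PrimeDivisor M} {s t : K}
    (hV : LocalizedAt V.ring s t) (hst : wedge s t ≠ 0) {c : K} (hc : c ≠ 0) :
    V.ordForm (c • wedge s t) = V.ord c := by
  have hreg (x : K) : x • wedge s t ∈ V.regularForms ↔ x ∈ V.ring := by
    constructor
    · intro hx
      have : ∀ ω ∈ V.regularForms, ∃ y ∈ V.ring, ω = y • wedge s t := by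
        intro ω hω
        induction hω using Submodule.span_induction with
        | mem x hx =>
          obtain ⟨f, hf, g, hg, rfl⟩ := hx
          exact hV.exists_wedge hf hg
        | zero => exact ⟨0, V.ring.zero_mem, by simp⟩
        | add x y _ _ hx hy =>
          obtain ⟨a, ha, rfl⟩ := hx
          obtain ⟨b, hb, rfl⟩ := hy
          exact ⟨a + b, V.ring.add_mem _ _ ha hb, by rw [add_smul]⟩
        | smul k x _ hx =>
          obtain ⟨a, ha, rfl⟩ := hx
          exact ⟨k * a, V.ring.mul_mem _ _ k.2 ha, by rw [mul_smul]; rfl⟩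
      obtain ⟨y, hy, hxy⟩ := this _ hx
      rwa [smul_left_injective K hst hxy]
    · intro hx
      exact Submodule.smul_mem _ (⟨x, hx⟩ : V.ring)
        (Submodule.subset_span ⟨s, hV.fst_mem, t, hV.snd_mem, rfl⟩)
  refine IsGreatest.csSup_eq ⟨⟨c, hc, rfl, ?_⟩, ?_⟩
  · rw [smul_smul, inv_mul_cancel₀ hc, hreg]
    exact V.ring.one_mem
  · rintro n ⟨f, hf, rfl, h⟩
    rw [smul_smul, hreg] at h
    have := V.ord_nonneg h
    rw [V.ord_mul (inv_ne_zero hf) hc, V.ord_inv] at this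
    omega

/-! ### The charts of the blow-ups -/

lemma q_ne_zero : q ≠ 0 := isCoordPair_q_p.fst_ne_zero

lemma p_ne_zero : p ≠ 0 := isCoordPair_q_p.snd_ne_zero

@[simp] lemma coord_zero (g₂ : ℂ) : (coord g₂ 0).1 = 1 / p := rfl

lemma coord_snd (g₂ : ℂ) (n : ℕ) : (coord g₂ n).2 = q / p := by
  induction n with
  | zero => rfl
  | succ n ih => exact ih

lemma q_div_p_ne_zero : q / p ≠ 0 := div_ne_zero q_ne_zero p_ne_zero

lemma coord_succ (g₂ : ℂ) (n : ℕ) : (coord g₂ (n + 1)).1 =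
    ((coord g₂ n).1 - algebraMap ℂ K (centre g₂ n)) / (q / p) := by
  rw [← coord_snd g₂ n]
  rfl

lemma coord_sub_centre (g₂ : ℂ) (n : ℕ) : (coord g₂ n).1 - algebraMap ℂ K (centre g₂ n) =
    (coord g₂ (n + 1)).1 * (q / p) := by
  rw [coord_succ, div_mul_cancel₀ _ q_div_p_ne_zero]

lemma coord_eq (g₂ : ℂ) (n : ℕ) : (coord g₂ n).1 = algebraMap ℂ K (centre g₂ n) +
    (coord g₂ (n + 1)).1 * (q / p) := by
  rw [← coord_sub_centre]
  ring

lemma isCoordPair_coord (g₂ : ℂ) (n : ℕ) : IsCoordPair (coord g₂ n).1 (q / p) := by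
  induction n with
  | zero =>
    have h1 := fst_mem_adjoin (1 / p) (q / p)
    have h2 := snd_mem_adjoin (1 / p) (q / p)
    refine isCoordPair_q_p.of_mem ?_ ?_
    · have h := div_mem h2 h1
      rwa [div_div_div_cancel_right₀ p_ne_zero, div_one] at h
    · have h := inv_mem h1
      rwa [one_div, inv_inv, ← one_div] at h
  | succ n ih =>
    have h1 := fst_mem_adjoin (coord g₂ (n + 1)).1 (q / p)
    have h2 := snd_mem_adjoin (coord g₂ (n + 1)).1 (q / p)
    refine ih.of_mem ?_ h2
    have h := add_mem (algebraMap_mem _ (centre g₂ n)) (mul_mem h1 h2)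
    rwa [← coord_eq] at h

/-- The other affine chart of the blow-up is also a coordinate plane. -/
lemma isCoordPair_coord' (g₂ : ℂ) (n : ℕ) :
    IsCoordPair (q / p / ((coord g₂ n).1 - algebraMap ℂ K (centre g₂ n)))
      ((coord g₂ n).1 - algebraMap ℂ K (centre g₂ n)) := by
  set u := (coord g₂ n).1 with hu
  set c := algebraMap ℂ K (centre g₂ n) with hc
  have h1 := fst_mem_adjoin (q / p / (u - c)) (u - c)
  have h2 := snd_mem_adjoin (q / p / (u - c)) (u - c)
  refine (isCoordPair_coord g₂ n).of_mem ?_ ?_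
  · rw [← hu, ← sub_add_cancel u c]
    nth_rw 3 [hc]
    exact add_mem (by simpa using h2) (algebraMap_mem _ _)
  · have h0 : u - c ≠ 0 := (isCoordPair_coord g₂ n).fst_sub_ne_zero _
    have hm := mul_mem h1 h2
    rwa [div_mul_cancel₀ _ h0] at hm

section Points

variable {M : Set (LocalSubring K)} {V : PrimeDivisor M}

lemma not_X_one_dvd (c : ℂ) : ¬ (X 1 : MvPolynomial (Fin 2) ℂ) ∣ X 0 + C c := by
  rintro ⟨d, hd⟩
  have := congrArg (eval ![1 - c, 0]) hd
  simp at this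

/-- The functions `s + c` do not vanish along the curve `t = 0`. -/
lemma LocalizedAt.ord_fst_add {s t : K} (hV : LocalizedAt V.ring s t) (h : IsCoordPair s t)
    (hpos : 0 < V.ord t) (c : ℂ) : V.ord (s + algebraMap ℂ K c) = 0 := by
  have hne : (X 0 + C c : MvPolynomial (Fin 2) ℂ) ≠ 0 := fun h0 =>
    not_X_one_dvd c (h0 ▸ dvd_zero _)
  have h1 := (hV.ord_pos_iff_dvd h (π := X 1) X_prime (by simpa using hpos) hne).not.2
    (not_X_one_dvd c)
  have h2 := V.ord_nonneg (hV.ev_mem (X 0 + C c))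
  simp only [map_add, ev_X_zero, ev_C] at h1 h2
  omega

/-- Inversion of the first coordinate: off the curve `s = 0`, the charts with coordinates `(s, t)`
and `(1 / s, s t)` have the same local rings. -/
lemma LocalizedAt.invert {A : ValuationSubring K} {s t : K} (hA : LocalizedAt A s t)
    (hs : s ≠ 0) (hsA : s⁻¹ ∈ A) : LocalizedAt A s⁻¹ (s * t) := by
  have hpoly (a : MvPolynomial (Fin 2) ℂ) :
      ∃ (n : ℕ) (b : MvPolynomial (Fin 2) ℂ), s⁻¹ ^ n * ev s t a = ev s⁻¹ (s * t) b := by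
    induction a using MvPolynomial.induction_on with
    | C c => exact ⟨0, C c, by simp⟩
    | add a b iha ihb =>
      obtain ⟨n, a', ha⟩ := iha
      obtain ⟨m, b', hb⟩ := ihb
      refine ⟨n + m, X 0 ^ m * a' + X 0 ^ n * b', ?_⟩
      simp only [map_add, map_mul, map_pow, ev_X_zero, ← ha, ← hb]
      ring
    | mul_X a i iha =>
      obtain ⟨n, a', ha⟩ := iha
      fin_cases i
      · refine ⟨n + 1, a', ?_⟩
        rw [← ha, pow_succ]
        simp only [Fin.zero_eta, map_mul, ev_X_zero]
        field_simp
      · refine ⟨n, a' * (X 0 * X 1), ?_⟩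
        simp only [Fin.mk_one, map_mul, ev_X_zero, ev_X_one, ← ha]
        field_simp
  refine ⟨fun a => ?_, fun x hx => ?_⟩
  · have hle : Algebra.adjoin ℂ {s⁻¹, s * t} ≤ ({ A.toSubring with
        algebraMap_mem' := fun c => by simpa using hA.ev_mem (C c) } : Subalgebra ℂ K) := by
      rw [Algebra.adjoin_le_iff]
      rintro x (rfl | rfl)
      · exact hsA
      · exact A.mul_mem _ _ hA.fst_mem hA.snd_mem
    exact hle (mem_adjoin_pair.2 ⟨a, rfl⟩)
  · obtain ⟨a, b, hb0, hb, rfl⟩ := hA.exists_div x hx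
    obtain ⟨n, a', ha'⟩ := hpoly a
    obtain ⟨m, b', hb'⟩ := hpoly b
    have hsi : s⁻¹ ≠ 0 := inv_ne_zero hs
    refine ⟨X 0 ^ m * a', X 0 ^ n * b', ?_, ?_, ?_⟩
    · simp only [map_mul, map_pow, ev_X_zero, ← hb']
      exact mul_ne_zero (pow_ne_zero _ hsi) (mul_ne_zero (pow_ne_zero _ hsi) hb0)
    · simp only [map_mul, map_pow, ev_X_zero, ← hb', mul_inv, ← inv_pow, inv_inv]
      exact A.mul_mem _ _ (pow_mem hA.fst_mem n) (A.mul_mem _ _ (pow_mem hA.fst_mem m) hb)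
    · simp only [map_mul, map_pow, ev_X_zero, ← hb', ← ha']
      field_simp

/-- `V` is the exceptional curve of the `n`-th blow-up: the curve `v = 0` in the chart with
coordinates `(u_n, v)`, where `v = q / p`. -/
structure IsExceptional (g₂ : ℂ) (n : ℕ) (V : PrimeDivisor M) : Prop where
  localizedAt : LocalizedAt V.ring (coord g₂ n).1 (q / p)
  ord_pos : 0 < V.ord (q / p)

lemma affineModel_congr {s t : Set K} (h : Algebra.adjoin ℂ s = Algebra.adjoin ℂ t) :
    affineModel s = affineModel t := by
  unfold affineModel
  rw [h]

lemma affineModel_insert_one (s t : K) : affineModel {1, s, t} = affineModel {s, t} := by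
  apply affineModel_congr
  apply le_antisymm
  · rw [Algebra.adjoin_le_iff]
    rintro x (rfl | hx)
    · exact one_mem _
    · exact Algebra.subset_adjoin hx
  · exact Algebra.adjoin_mono (Set.subset_insert _ _)

lemma mem_projPlane_iff {A : ValuationSubring K} : A.toLocalSubring ∈ projPlane ↔
    LocalizedAt A q p ∨ LocalizedAt A q⁻¹ (p / q) ∨ LocalizedAt A (1 / p) (q / p) := by
  have hr (f : Fin 3 → K) : Set.range f = {f 0, f 1, f 2} := by
    ext x
    simp [Fin.exists_fin_succ, eq_comm]
  have h0 : affineModel (Set.range fun j => homCoord j / homCoord 0) = affineModel {q, p} := by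
    rw [hr, ← affineModel_insert_one]
    simp [homCoord]
  have h1 : affineModel (Set.range fun j => homCoord j / homCoord 1) =
      affineModel {q⁻¹, p / q} := by
    rw [hr, ← affineModel_insert_one]
    simp [homCoord, q_ne_zero, Set.insert_comm]
  have h2 : affineModel (Set.range fun j => homCoord j / homCoord 2) =
      affineModel {1 / p, q / p} := by
    rw [hr, ← affineModel_insert_one]
    congr 1
    ext x
    simp [homCoord, p_ne_zero]
    tauto
  rw [projPlane, Set.mem_iUnion, Fin.exists_fin_succ, Fin.exists_fin_succ, Fin.exists_fin_one]
  change _ ∈ affineModel (Set.range fun j => homCoord j / homCoord 0) ∨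
    _ ∈ affineModel (Set.range fun j => homCoord j / homCoord 1) ∨
    _ ∈ affineModel (Set.range fun j => homCoord j / homCoord 2) ↔ _
  rw [h0, h1, h2, mem_affineModel_iff, mem_affineModel_iff, mem_affineModel_iff]

/-- No curve of the plane is mapped to the point `b₁`. -/
lemma not_centred_of_mem_projPlane (hV : V.ring.toLocalSubring ∈ projPlane)
    (hu : 0 < V.ord (1 / p)) (hv : 0 < V.ord (q / p)) : False := by
  rcases mem_projPlane_iff.1 hV with h | h | h
  · have := V.ord_nonneg h.snd_mem
    rw [one_div, V.ord_inv] at hu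
    omega
  · have := V.ord_nonneg h.snd_mem
    rw [← inv_div, V.ord_inv] at hv
    omega
  · have := h.ord_fst_add (isCoordPair_coord 0 0) hv 0
    simp only [map_zero, add_zero] at this
    omega

/-- A curve mapped to the point `b_{n+1}` is mapped to all the previous points `b_{m+1}`. -/
lemma ord_coord_sub_pos_of_le (g₂ : ℂ) (hv : 0 < V.ord (q / p)) {m n : ℕ} (hmn : m ≤ n)
    (h : 0 < V.ord ((coord g₂ n).1 - algebraMap ℂ K (centre g₂ n))) :
    0 < V.ord ((coord g₂ m).1 - algebraMap ℂ K (centre g₂ m)) := by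
  induction n, hmn using Nat.le_induction with
  | base => exact h
  | succ n hmn ih =>
    apply ih
    have hne := (isCoordPair_coord g₂ (n + 1)).fst_sub_ne_zero (centre g₂ (n + 1))
    have hmem := V.ring.add_mem _ _ ((V.ord_nonneg_iff hne).1 h.le)
      (V.algebraMap_mem (centre g₂ (n + 1)))
    rw [sub_add_cancel] at hmem
    have := V.ord_nonneg hmem
    rw [coord_sub_centre, V.ord_mul (isCoordPair_coord g₂ (n + 1)).fst_ne_zero q_div_p_ne_zero]
    omega

lemma vanishesAt_coord_iff (g₂ : ℂ) (n : ℕ) :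
    VanishesAt ((coord g₂ n).1 - algebraMap ℂ K (centre g₂ n)) V.ring.toLocalSubring ∧
      VanishesAt (coord g₂ n).2 V.ring.toLocalSubring ↔
    0 < V.ord ((coord g₂ n).1 - algebraMap ℂ K (centre g₂ n)) ∧ 0 < V.ord (q / p) := by
  rw [vanishesAt_iff V ((isCoordPair_coord g₂ n).fst_sub_ne_zero _), coord_snd,
    vanishesAt_iff V q_div_p_ne_zero]

lemma not_vanishesAt_of_mem_projPlane (hV : V.ring.toLocalSubring ∈ projPlane) (g₂ : ℂ) (n : ℕ) :
    ¬ (VanishesAt ((coord g₂ n).1 - algebraMap ℂ K (centre g₂ n)) V.ring.toLocalSubring ∧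
      VanishesAt (coord g₂ n).2 V.ring.toLocalSubring) := by
  rw [vanishesAt_coord_iff]
  rintro ⟨hu, hv⟩
  have := ord_coord_sub_pos_of_le g₂ hv (Nat.zero_le n) hu
  refine not_centred_of_mem_projPlane hV ?_ hv
  simpa [centre] using this

lemma mem_stage_of_mem_projPlane (hV : V.ring.toLocalSubring ∈ projPlane) (g₂ : ℂ) (n : ℕ) :
    V.ring.toLocalSubring ∈ stage g₂ n := by
  induction n with
  | zero => exact hV
  | succ n ih => exact Or.inl ⟨ih, not_vanishesAt_of_mem_projPlane hV g₂ n⟩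

/-- The curves on a blow-up are the strict transforms of curves in the plane and the exceptional
curves. -/
lemma mem_projPlane_or_isExceptional (g₂ : ℂ) (n : ℕ) (hV : V.ring.toLocalSubring ∈ stage g₂ n) :
    V.ring.toLocalSubring ∈ projPlane ∨ ∃ k, 1 ≤ k ∧ k ≤ n ∧ IsExceptional g₂ k V := by
  induction n with
  | zero => exact Or.inl hV
  | succ n ih =>
    rcases hV with ⟨hV, -⟩ | ⟨hV, hvan⟩
    · rcases ih hV with h | ⟨k, hk1, hkn, hk⟩
      · exact Or.inl h
      · exact Or.inr ⟨k, hk1, hkn.trans n.le_succ, hk⟩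
    · refine Or.inr ⟨n + 1, by omega, le_rfl, ?_⟩
      rw [vanishesAt_coord_iff] at hvan
      rw [coord_snd] at hV
      refine ⟨?_, hvan.2⟩
      rcases hV with hV | hV
      · -- the exceptional curve is visible in both charts, so it suffices to change the chart
        rw [mem_affineModel_iff] at hV
        have hc := isCoordPair_coord' g₂ n
        have h0 := hV.ord_fst_add hc hvan.1 0
        rw [map_zero, add_zero] at h0
        have hinv := hV.invert hc.fst_ne_zero
          ((V.ord_nonneg_iff (inv_ne_zero hc.fst_ne_zero)).1 (by rw [V.ord_inv, h0, neg_zero]))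
        rw [div_mul_cancel₀ _ hc.snd_ne_zero, inv_div, ← coord_succ] at hinv
        exact hinv
      · rw [mem_affineModel_iff, ← coord_succ] at hV
        exact hV

end Points

/-! ### Orders along the exceptional curves -/

lemma coord_zero_eq_pow (g₂ : ℂ) {n : ℕ} (hn : n ≤ 3) :
    1 / p = (q / p) ^ n * (coord g₂ n).1 := by
  induction n with
  | zero => simp
  | succ n ih =>
    have h := coord_eq g₂ n
    rw [centre, if_neg (by omega), if_neg (by omega), map_zero, zero_add] at h
    rw [ih (by omega), h]
    ring

lemma coord_three_eq (g₂ : ℂ) : (coord g₂ 3).1 = 4 + (q / p) * (coord g₂ 4).1 := by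
  rw [coord_eq, centre, if_pos rfl, map_ofNat, mul_comm]

lemma coord_four_eq_pow (g₂ : ℂ) {n : ℕ} (h4 : 4 ≤ n) (hn : n ≤ 7) :
    (coord g₂ 4).1 = (q / p) ^ (n - 4) * (coord g₂ n).1 := by
  induction n, h4 using Nat.le_induction with
  | base => simp
  | succ n hmn ih =>
    have h := coord_eq g₂ n
    rw [centre, if_neg (by omega), if_neg (by omega), map_zero, zero_add] at h
    rw [ih (by omega), h, Nat.sub_add_comm hmn]
    ring

lemma coord_seven_eq (g₂ : ℂ) : (coord g₂ 7).1 =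
    -16 * algebraMap ℂ K g₂ + (q / p) * (coord g₂ 8).1 := by
  rw [coord_eq, centre, if_neg (by decide), if_pos rfl, map_mul, map_neg, map_ofNat,
    mul_comm (q / p)]

lemma coord_eight_eq (g₂ : ℂ) : (coord g₂ 8).1 = (q / p) * (coord g₂ 9).1 := by
  rw [coord_eq]
  simp [centre, mul_comm]

/-- The Weierstrass polynomial `p² - 4 q³ + g₂ q`. -/
def weierstrass (g₂ : ℂ) : K := p ^ 2 - 4 * q ^ 3 + algebraMap ℂ K g₂ * q

/-- The equation of the Weierstrass cubic in terms of `v = q / p` and `y = u₃`. -/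
lemma weierstrass_add_eq (g₂ g₃ : ℂ) : weierstrass g₂ + algebraMap ℂ K g₃ =
    (q / p) ^ 3 * ((coord g₂ 3).1 - 4 + algebraMap ℂ K g₂ * (q / p) ^ 4 * (coord g₂ 3).1 ^ 2 +
      algebraMap ℂ K g₃ * (q / p) ^ 6 * (coord g₂ 3).1 ^ 3) / (1 / p) ^ 3 := by
  have h := coord_zero_eq_pow g₂ (n := 3) le_rfl
  have hp := p_ne_zero
  have hq := q_ne_zero
  have hy : (coord g₂ 3).1 = p ^ 2 / q ^ 3 := by
    rw [div_pow] at h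
    field_simp at h ⊢
    linear_combination -h
  rw [hy, weierstrass]
  field_simp

section Exceptional

variable {M : Set (LocalSubring K)} {V : PrimeDivisor M} {g₂ : ℂ} {n : ℕ}

namespace IsExceptional

lemma ord_v (h : IsExceptional g₂ n V) : V.ord (q / p) = 1 := by
  have := h.localizedAt.ord_prime (isCoordPair_coord g₂ n) (π := X 1) X_prime
    (by simpa using h.ord_pos)
  simpa using this

lemma v_mem (h : IsExceptional g₂ n V) : q / p ∈ V.ring := h.localizedAt.snd_mem

lemma u_mem (h : IsExceptional g₂ n V) {m : ℕ} (hm : m ≤ n) : (coord g₂ m).1 ∈ V.ring := by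
  induction hm using Nat.decreasingInduction with
  | self => exact h.localizedAt.fst_mem
  | of_succ m hm ih =>
    rw [coord_eq]
    exact V.ring.add_mem _ _ (V.algebraMap_mem _) (V.ring.mul_mem _ _ ih h.v_mem)

/-- The function `u_n` restricts to a coordinate of the exceptional curve; in particular the
functions `u_n + c` do not vanish along it. -/
lemma ord_u_add (h : IsExceptional g₂ n V) (c : ℂ) {w : K} (hw : w ∈ V.ring) :
    V.ord ((coord g₂ n).1 + algebraMap ℂ K c + (q / p) * w) = 0 := by
  have h0 := h.localizedAt.ord_fst_add (isCoordPair_coord g₂ n) h.ord_pos c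
  rw [V.ord_add_eq_left _ _, h0]
  · have := (isCoordPair_coord g₂ n).fst_sub_ne_zero (-c)
    rwa [map_neg, sub_neg_eq_add] at this
  · intro hne
    rw [h0, V.ord_mul q_div_p_ne_zero (right_ne_zero_of_mul hne), h.ord_v]
    have := V.ord_nonneg hw
    omega

lemma ord_pow_mul (h : IsExceptional g₂ n V) (c : ℂ) {w : K} (hw : w ∈ V.ring) (k : ℕ) :
    V.ord ((q / p) ^ k * ((coord g₂ n).1 + algebraMap ℂ K c + (q / p) * w)) = k := by
  have hne : (coord g₂ n).1 + algebraMap ℂ K c + (q / p) * w ≠ 0 := by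
    intro h0
    -- `u_n` would be congruent to a constant modulo `v`
    have h1 := h.localizedAt.ord_fst_add (isCoordPair_coord g₂ n) h.ord_pos c
    have h2 := (isCoordPair_coord g₂ n).fst_sub_ne_zero (-c)
    have h3 : (coord g₂ n).1 + algebraMap ℂ K c = -((q / p) * w) := by
      linear_combination h0
    rw [map_neg, sub_neg_eq_add, h3] at h2
    rw [h3, V.ord_neg, V.ord_mul q_div_p_ne_zero (right_ne_zero_of_mul (neg_ne_zero.1 h2)),
      h.ord_v] at h1
    have := V.ord_nonneg hw
    omega
  rw [V.ord_mul (pow_ne_zero _ q_div_p_ne_zero) hne, h.ord_u_add c hw, V.ord_pow, h.ord_v]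
  simp

/-- The first three blow-ups take place on the strict transform of the line `x₀ = 0`, which has the
local equation `u₀ = 1 / p`. -/
lemma ord_coord_zero (h : IsExceptional g₂ n V) : V.ord (1 / p) = min n 3 := by
  rcases le_total n 3 with hn | hn
  · have := h.ord_pow_mul 0 V.ring.zero_mem n
    rw [map_zero, mul_zero, add_zero, add_zero, ← coord_zero_eq_pow g₂ hn] at this
    omega
  · rcases hn.eq_or_lt with rfl | hn
    · have := h.ord_pow_mul 0 V.ring.zero_mem 3
      rw [map_zero, mul_zero, add_zero, add_zero, ← coord_zero_eq_pow g₂ le_rfl] at this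
      omega
    · have h4 : (4 : K) = algebraMap ℂ K 4 := (map_ofNat (algebraMap ℂ K) 4).symm
      have hu3 : V.ord (coord g₂ 3).1 = 0 := by
        rw [coord_three_eq, h4, V.ord_add_eq_left (by rw [Ne, map_eq_zero]; norm_num),
          V.ord_algebraMap]
        intro hne
        rw [V.ord_algebraMap, V.ord_mul q_div_p_ne_zero (right_ne_zero_of_mul hne), h.ord_v]
        have := V.ord_nonneg (h.u_mem (m := 4) (by omega))
        omega
      rw [coord_zero_eq_pow g₂ le_rfl, V.ord_mul (pow_ne_zero _ q_div_p_ne_zero)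
        (isCoordPair_coord g₂ 3).fst_ne_zero, V.ord_pow, h.ord_v, hu3]
      omega

/-- The Weierstrass cubics pass through all the points `b_i`: their strict transforms do not
contain any exceptional curve. -/
lemma ord_weierstrass (h : IsExceptional g₂ n V) (h1 : 1 ≤ n) (h9 : n ≤ 9) (g₃ : ℂ) :
    V.ord (weierstrass g₂ + algebraMap ℂ K g₃) = n - 3 * min n 3 := by
  set a := algebraMap ℂ K g₂ with ha
  set b := algebraMap ℂ K g₃ with hb
  set v := q / p with hv
  set y := (coord g₂ 3).1 with hy
  set x := (coord g₂ n).1 with hx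
  have ham : a ∈ V.ring := V.algebraMap_mem _
  have hbm : b ∈ V.ring := V.algebraMap_mem _
  have hvm : v ∈ V.ring := h.v_mem
  have hxm : x ∈ V.ring := h.u_mem le_rfl
  -- it suffices to write the numerator of the Weierstrass polynomial in the form
  -- `v ^ n * (u_n + c + v * w)`
  suffices hs : ∃ c : ℂ, ∃ w ∈ V.ring, v ^ 3 * (y - 4 + a * v ^ 4 * y ^ 2 + b * v ^ 6 * y ^ 3) =
      v ^ n * (x + algebraMap ℂ K c + v * w) by
    obtain ⟨c, w, hw, hcw⟩ := hs
    have hp3 : ((1 : K) / p) ^ 3 ≠ 0 := pow_ne_zero _ (one_div_ne_zero p_ne_zero)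
    have hord := h.ord_pow_mul c hw n
    have hne : v ^ n * (x + algebraMap ℂ K c + v * w) ≠ 0 := by
      intro h0
      rw [h0, V.ord_zero] at hord
      omega
    rw [weierstrass_add_eq, hcw, V.ord_div hne hp3, hord, V.ord_pow, h.ord_coord_zero]
    simp
  have hv3 : v ^ 3 * y = (1 : K) / p := (coord_zero_eq_pow g₂ le_rfl).symm
  rcases le_or_gt n 3 with hn | hn
  · have hxn : v ^ n * x = v ^ 3 * y := by rw [hv3, hx, coord_zero_eq_pow g₂ hn]
    have hv0 : v ≠ 0 := q_div_p_ne_zero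
    interval_cases n
    · refine ⟨0, -4 * v + a * v * x ^ 2 + b * v * x ^ 3, by
        with_reducible repeat' first
          | assumption | apply add_mem | apply mul_mem | apply pow_mem | apply neg_mem
          | apply ofNat_mem, ?_⟩
      have : x = v ^ 2 * y := mul_left_cancel₀ hv0 (by linear_combination hxn)
      rw [map_zero, this]
      ring
    · refine ⟨0, -4 + a * v ^ 2 * x ^ 2 + b * v ^ 3 * x ^ 3, by
        with_reducible repeat' first
          | assumption | apply add_mem | apply mul_mem | apply pow_mem | apply neg_mem
          | apply ofNat_mem, ?_⟩
      have : x = v * y := mul_left_cancel₀ (pow_ne_zero 2 hv0) (by linear_combination hxn)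
      rw [map_zero, this]
      ring
    · refine ⟨-4, a * v ^ 3 * x ^ 2 + b * v ^ 5 * x ^ 3, by
        with_reducible repeat' first
          | assumption | apply add_mem | apply mul_mem | apply pow_mem, ?_⟩
      have : x = y := hx.trans hy.symm
      rw [map_neg, map_ofNat, this]
      ring
  -- from here on `y = 4 + v u₄`, so that `y - 4` is divisible by `v`
  have hym : y ∈ V.ring := h.u_mem (by omega)
  have hy4 : y = 4 + v * (coord g₂ 4).1 := coord_three_eq g₂
  rcases le_or_gt n 7 with hn7 | hn7
  · have hx4 : (coord g₂ 4).1 = v ^ (n - 4) * x := coord_four_eq_pow g₂ hn hn7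
    rcases hn7.eq_or_lt with rfl | hn7
    · -- the value `16 g₂` of `g₂ y²` at `v = 0` is compensated by the centre `-16 g₂`
      refine ⟨16 * g₂, a * (8 * v ^ 3 * x + v ^ 7 * x ^ 2) + b * v * y ^ 3, by
        with_reducible repeat' first
          | assumption | apply add_mem | apply mul_mem | apply pow_mem | apply neg_mem
          | apply ofNat_mem, ?_⟩
      rw [map_mul, map_ofNat, hy4, hx4]
      ring
    · refine ⟨0, a * v ^ (6 - n) * y ^ 2 + b * v ^ (8 - n) * y ^ 3, by
        with_reducible repeat' first
          | assumption | apply add_mem | apply mul_mem | apply pow_mem, ?_⟩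
      rw [map_zero]
      interval_cases n <;> linear_combination v ^ 3 * hy4 + v ^ 4 * hx4
  · have hz : (coord g₂ 4).1 = v ^ 3 * (-16 * a + v * (coord g₂ 8).1) := by
      rw [coord_four_eq_pow g₂ (by norm_num) le_rfl, coord_seven_eq]
    set z := -16 * a + v * (coord g₂ 8).1 with hz'
    have hzm : z ∈ V.ring := by
      have := h.u_mem (m := 8) hn7
      with_reducible repeat' first
          | assumption | apply add_mem | apply mul_mem | apply pow_mem | apply neg_mem
          | apply ofNat_mem
    rw [hz] at hy4
    have h89 : n = 8 ∨ n = 9 := by omega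
    rcases h89 with rfl | rfl
    · refine ⟨0, a * (8 * v ^ 2 * z + v ^ 6 * z ^ 2) + b * y ^ 3, by
        with_reducible repeat' first
          | assumption | apply add_mem | apply mul_mem | apply pow_mem | apply neg_mem
          | apply ofNat_mem, ?_⟩
      have hzx : z = -16 * a + v * x := rfl
      rw [map_zero, hy4]
      linear_combination v ^ 7 * hzx
    · -- the constant `64 g₃` is the value of `g₃ y³` at `v = 0`
      refine ⟨64 * g₃, a * (8 * v * z + v ^ 5 * z ^ 2) +
        b * (48 * v ^ 3 * z + 12 * v ^ 7 * z ^ 2 + v ^ 11 * z ^ 3), by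
        with_reducible repeat' first
          | assumption | apply add_mem | apply mul_mem | apply pow_mem | apply neg_mem
          | apply ofNat_mem, ?_⟩
      have hzx : z = -16 * a + v * (v * x) := by rw [hz', coord_eight_eq]
      rw [map_mul, map_ofNat, hy4]
      linear_combination v ^ 7 * hzx

end IsExceptional

end Exceptional

/-! ### The divisor `D` and the canonical divisors -/

section Surface

variable {g₂ : ℂ}

lemma formDivisor_X_zero {M : Set (LocalSubring K)} (V : PrimeDivisor M) :
    formDivisor M 1 (X 0) V = -min 0 (min (V.ord q) (V.ord p)) := by
  simp [formDivisor, homCoord]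

/-- The divisor `D` is `3 H - E_1 - ⋯ - E_9`. -/
lemma D_apply (V : PrimeDivisor (surfaceS g₂)) :
    D g₂ V = 3 * H g₂ V - ∑ i ∈ Finset.range 9, E g₂ (i + 1) V := by
  simp only [D, Dcomp, Finset.sum_apply, Pi.smul_apply, Fin.sum_univ_succ, Finset.sum_range_succ]
  simp [Fin.ext_iff]
  ring

lemma E_succ_eq_min {V : PrimeDivisor (surfaceS g₂)} {n : ℕ}
    (hu : 0 < V.ord ((coord g₂ n).1 - algebraMap ℂ K (centre g₂ n))) (hv : 0 < V.ord (q / p)) :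
    E g₂ (n + 1) V =
      min (V.ord ((coord g₂ n).1 - algebraMap ℂ K (centre g₂ n))) (V.ord (q / p)) := by
  rw [E, excDivisor, Nat.add_sub_cancel, if_pos ((vanishesAt_coord_iff g₂ n).2 ⟨hu, hv⟩),
    coord_snd]

lemma E_succ_eq_zero {V : PrimeDivisor (surfaceS g₂)} {n : ℕ}
    (h : ¬ (0 < V.ord ((coord g₂ n).1 - algebraMap ℂ K (centre g₂ n)) ∧ 0 < V.ord (q / p))) :
    E g₂ (n + 1) V = 0 := by
  rw [E, excDivisor, Nat.add_sub_cancel, if_neg ((vanishesAt_coord_iff g₂ n).not.2 h)]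

lemma H_nonneg (V : PrimeDivisor (surfaceS g₂)) : 0 ≤ H g₂ V := by
  rw [H, formDivisor_X_zero]
  omega

lemma D_of_mem_projPlane {V : PrimeDivisor (surfaceS g₂)}
    (hV : V.ring.toLocalSubring ∈ projPlane) : D g₂ V = 3 * H g₂ V := by
  rw [D_apply, Finset.sum_eq_zero, sub_zero]
  intro i _
  exact E_succ_eq_zero ((vanishesAt_coord_iff g₂ i).not.1 (not_vanishesAt_of_mem_projPlane hV g₂ i))

namespace IsExceptional

variable {V : PrimeDivisor (surfaceS g₂)} {n : ℕ}

lemma E_of_lt (h : IsExceptional g₂ n V) {m : ℕ} (hm : m < n) : E g₂ (m + 1) V = 1 := by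
  have h1 := V.ord_nonneg (h.u_mem (m := m + 1) hm)
  have h2 : V.ord ((coord g₂ m).1 - algebraMap ℂ K (centre g₂ m)) =
      V.ord (coord g₂ (m + 1)).1 + 1 := by
    rw [coord_sub_centre, V.ord_mul (isCoordPair_coord g₂ (m + 1)).fst_ne_zero q_div_p_ne_zero,
      h.ord_v]
  rw [E_succ_eq_min (by omega) h.ord_pos, h2, h.ord_v]
  omega

lemma E_of_le (h : IsExceptional g₂ n V) {m : ℕ} (hm : n ≤ m) : E g₂ (m + 1) V = 0 := by
  refine E_succ_eq_zero ?_
  rintro ⟨hu, hv⟩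
  have h1 := ord_coord_sub_pos_of_le g₂ hv hm hu
  have h2 := h.localizedAt.ord_fst_add (isCoordPair_coord g₂ n) hv (-centre g₂ n)
  rw [map_neg, ← sub_eq_add_neg] at h2
  omega

lemma H_eq (h : IsExceptional g₂ n V) (h1 : 1 ≤ n) : H g₂ V = min n 3 := by
  have h2 := h.ord_coord_zero
  have h3 := h.ord_v
  rw [V.ord_div q_ne_zero p_ne_zero] at h3
  rw [one_div, V.ord_inv] at h2
  rw [H, formDivisor_X_zero]
  omega

lemma D_eq (h : IsExceptional g₂ n V) (h1 : 1 ≤ n) (h9 : n ≤ 9) :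
    D g₂ V = 3 * min n 3 - n := by
  have hsum : ∑ i ∈ Finset.range 9, E g₂ (i + 1) V = n := by
    rw [← Finset.sum_subset (Finset.range_subset_range.2 h9),
      Finset.sum_congr rfl fun i hi => h.E_of_lt (Finset.mem_range.1 hi)]
    · simp
    · intro i _ hi
      exact h.E_of_le (by simpa using hi)
  rw [D_apply, hsum, h.H_eq h1]

end IsExceptional

lemma mem_projPlane_or_isExceptional' (V : PrimeDivisor (surfaceS g₂)) :
    V.ring.toLocalSubring ∈ projPlane ∨ ∃ n, 1 ≤ n ∧ n ≤ 9 ∧ IsExceptional g₂ n V :=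
  mem_projPlane_or_isExceptional g₂ 9 V.mem

lemma wedge_eq {s t f g α β γ δ : K}
    (hf : KaehlerDifferential.D ℂ K f =
      α • KaehlerDifferential.D ℂ K s + β • KaehlerDifferential.D ℂ K t)
    (hg : KaehlerDifferential.D ℂ K g =
      γ • KaehlerDifferential.D ℂ K s + δ • KaehlerDifferential.D ℂ K t) :
    wedge f g = (α * δ - β * γ) • wedge s t := by
  rw [wedge, hf, hg, alternatingMap_pair, wedge]

lemma differential_inv (f : K) : KaehlerDifferential.D ℂ K f⁻¹ =
    (-f⁻¹ ^ 2) • KaehlerDifferential.D ℂ K f := by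
  rw [Derivation.leibniz_inv]

lemma wedge_q_p_eq : wedge q p = p ^ 3 • wedge (1 / p) (q / p) := by
  have hp := p_ne_zero
  have h1 : KaehlerDifferential.D ℂ K p = (-p ^ 2) • KaehlerDifferential.D ℂ K (1 / p) +
      (0 : K) • KaehlerDifferential.D ℂ K (q / p) := by
    have := differential_inv p⁻¹
    rw [inv_inv] at this
    rw [this, zero_smul, add_zero, one_div]
  have h2 : KaehlerDifferential.D ℂ K q =
      (q / p * (-p ^ 2)) • KaehlerDifferential.D ℂ K (1 / p) +
      p • KaehlerDifferential.D ℂ K (q / p) := by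
    conv_lhs => rw [← div_mul_cancel₀ q hp]
    rw [Derivation.leibniz, h1, zero_smul, add_zero, smul_smul]
  rw [wedge_eq h2 h1]
  congr 1
  ring

/-- Each curve of the plane lies in a standard chart, with coordinates `(s, t)` and equation `x = 0`
of the line at infinity `x₀ = 0`, where `dq ∧ dp = ± x⁻³ ds ∧ dt`. -/
lemma exists_chart {M : Set (LocalSubring K)} {V : PrimeDivisor M}
    (hV : V.ring.toLocalSubring ∈ projPlane) : ∃ s t x : K, LocalizedAt V.ring s t ∧ x ≠ 0 ∧
      x ∈ V.ring ∧ x * q ∈ V.ring ∧ x * p ∈ V.ring ∧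
      V.ord x = -min 0 (min (V.ord q) (V.ord p)) ∧
      ∃ ε : K, ε ^ 2 = 1 ∧ wedge q p = (ε * x⁻¹ ^ 3) • wedge s t := by
  have hq := q_ne_zero
  have hp := p_ne_zero
  rcases mem_projPlane_iff.1 hV with h | h | h
  · refine ⟨q, p, 1, h, one_ne_zero, V.ring.one_mem, by simpa using h.fst_mem,
      by simpa using h.snd_mem, ?_, 1, by simp, by simp⟩
    have h1 := V.ord_nonneg h.fst_mem
    have h2 := V.ord_nonneg h.snd_mem
    rw [V.ord_one]
    omega
  · refine ⟨q⁻¹, p / q, q⁻¹, h, inv_ne_zero hq, h.fst_mem, ?_, ?_, ?_, -1, by ring, ?_⟩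
    · rw [inv_mul_cancel₀ hq]
      exact V.ring.one_mem
    · rw [inv_mul_eq_div]
      exact h.snd_mem
    · have h1 := V.ord_nonneg h.fst_mem
      have h2 := V.ord_nonneg h.snd_mem
      rw [V.ord_div hp hq] at h2
      rw [V.ord_inv] at h1 ⊢
      omega
    · have h1 : KaehlerDifferential.D ℂ K q = (-q ^ 2) • KaehlerDifferential.D ℂ K q⁻¹ +
          (0 : K) • KaehlerDifferential.D ℂ K (p / q) := by
        have := differential_inv q⁻¹
        rw [inv_inv] at this
        rw [this, zero_smul, add_zero]
      have h2 : KaehlerDifferential.D ℂ K p =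
          (p / q * (-q ^ 2)) • KaehlerDifferential.D ℂ K q⁻¹ +
          q • KaehlerDifferential.D ℂ K (p / q) := by
        conv_lhs => rw [← div_mul_cancel₀ p hq]
        rw [Derivation.leibniz, h1, zero_smul, add_zero, smul_smul]
      rw [wedge_eq h1 h2]
      congr 1
      field_simp
      ring
  · refine ⟨1 / p, q / p, p⁻¹, h, inv_ne_zero hp, by simpa using h.fst_mem, ?_, ?_, ?_, 1,
      by ring, ?_⟩
    · rw [inv_mul_eq_div]
      exact h.snd_mem
    · rw [inv_mul_cancel₀ hp]
      exact V.ring.one_mem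
    · have h1 := V.ord_nonneg h.fst_mem
      have h2 := V.ord_nonneg h.snd_mem
      rw [V.ord_div hq hp] at h2
      rw [one_div, V.ord_inv] at h1
      rw [V.ord_inv]
      omega
    · rw [wedge_q_p_eq, inv_inv, one_mul]

lemma wedge_coord (g₂ : ℂ) (n : ℕ) :
    wedge (1 / p) (q / p) = (q / p) ^ n • wedge (coord g₂ n).1 (q / p) := by
  induction n with
  | zero => simp
  | succ n ih =>
    have h1 : KaehlerDifferential.D ℂ K (coord g₂ n).1 =
        (q / p) • KaehlerDifferential.D ℂ K (coord g₂ (n + 1)).1 +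
        (coord g₂ (n + 1)).1 • KaehlerDifferential.D ℂ K (q / p) := by
      rw [coord_eq, map_add, Derivation.map_algebraMap, zero_add, Derivation.leibniz, add_comm]
    have h2 : KaehlerDifferential.D ℂ K (q / p) =
        (0 : K) • KaehlerDifferential.D ℂ K (coord g₂ (n + 1)).1 +
        (1 : K) • KaehlerDifferential.D ℂ K (q / p) := by
      rw [zero_smul, one_smul, zero_add]
    rw [ih, wedge_eq h1 h2, smul_smul]
    congr 1
    ring

/-- The divisor of the 2-form `h dq ∧ dp` is `div h - D`. -/
lemma ordForm_smul_wedge (V : PrimeDivisor (surfaceS g₂)) {h : K} (hh : h ≠ 0)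
    (hω : wedge q p ≠ 0) : V.ordForm (h • wedge q p) = V.ord h - D g₂ V := by
  rcases mem_projPlane_or_isExceptional' V with hV | ⟨n, h1, h9, hn⟩
  · obtain ⟨s, t, x, hst, hx0, -, -, -, hx, ε, hε, hw⟩ := exists_chart hV
    have hε0 : ε ≠ 0 := by
      rintro rfl
      simp at hε
    have hε1 : V.ord ε = 0 := by
      have := V.ord_pow ε 2
      rw [hε, V.ord_one] at this
      omega
    have hst0 : wedge s t ≠ 0 := by
      intro h0
      rw [hw, h0, smul_zero] at hω
      exact hω rfl
    have hx3 : x⁻¹ ^ 3 ≠ 0 := pow_ne_zero 3 (inv_ne_zero hx0)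
    rw [hw, smul_smul, hst.ordForm_smul hst0 (mul_ne_zero hh (mul_ne_zero hε0 hx3)),
      V.ord_mul hh (mul_ne_zero hε0 hx3), V.ord_mul hε0 hx3, hε1, V.ord_pow, V.ord_inv,
      D_of_mem_projPlane hV, H, formDivisor_X_zero, hx]
    push_cast
    ring
  · have hw : wedge q p = (p ^ 3 * (q / p) ^ n) • wedge (coord g₂ n).1 (q / p) := by
      rw [wedge_q_p_eq, wedge_coord g₂ n, smul_smul]
    have hst0 : wedge (coord g₂ n).1 (q / p) ≠ 0 := by
      intro h0
      rw [hw, h0, smul_zero] at hω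
      exact hω rfl
    have h2 := hn.ord_coord_zero
    rw [one_div, V.ord_inv] at h2
    have hp3 : p ^ 3 ≠ 0 := pow_ne_zero 3 p_ne_zero
    have hvn : (q / p) ^ n ≠ 0 := pow_ne_zero n q_div_p_ne_zero
    rw [hw, smul_smul, hn.localizedAt.ordForm_smul hst0 (mul_ne_zero hh (mul_ne_zero hp3 hvn)),
      V.ord_mul hh (mul_ne_zero hp3 hvn), V.ord_mul hp3 hvn, V.ord_pow, V.ord_pow, hn.ord_v,
      hn.D_eq h1 h9]
    push_cast at h2 ⊢
    linarith

/-! ### The strict transforms of the Weierstrass cubics -/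

lemma aeval_weierstrassForm (g₂ g₃ : ℂ) :
    aeval homCoord (weierstrassForm g₂ g₃) = weierstrass g₂ + algebraMap ℂ K g₃ := by
  simp [weierstrassForm, weierstrass, homCoord]

lemma weierstrass_add_ne_zero (g₂ g₃ : ℂ) : weierstrass g₂ + algebraMap ℂ K g₃ ≠ 0 := by
  have h4 : ev q p 4 = (4 : K) := map_ofNat _ 4
  have : weierstrass g₂ + algebraMap ℂ K g₃ =
      ev q p (X 1 ^ 2 - 4 * X 0 ^ 3 + C g₂ * X 0 + C g₃) := by
    simp [weierstrass, h4]
  rw [this, Ne, isCoordPair_q_p.ev_eq_zero_iff]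
  intro h0
  obtain ⟨z, hz⟩ := IsAlgClosed.exists_pow_nat_eq (1 - g₃) (n := 2) (by norm_num)
  have h := congrArg (eval ![0, z]) h0
  simp [hz] at h

/-- The strict transform of the Weierstrass cubic with parameter `g₃` is the divisor of zeros of
`p² - 4 q³ + g₂ q + g₃`, viewed as a section of the sheaf of `D`. -/
lemma weierstrassStrict_eq (g₂ g₃ : ℂ) : weierstrassStrict g₂ g₃ =
    divFun (surfaceS g₂) (weierstrass g₂ + algebraMap ℂ K g₃) + D g₂ := by
  funext V
  rw [Pi.add_apply, divFun, weierstrassStrict, strictTransform]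
  rcases mem_projPlane_or_isExceptional' V with hV | ⟨n, h1, h9, hn⟩
  · rw [dif_pos hV, D_of_mem_projPlane hV, H, formDivisor_X_zero, formDivisor,
      aeval_weierstrassForm]
    change V.ord _ - ((3 : ℕ) : ℤ) * min 0 (min (V.ord q) (V.ord p)) = _
    push_cast
    ring
  · rw [dif_neg, hn.D_eq h1 h9, hn.ord_weierstrass h1 h9]
    · ring
    · intro hV
      refine not_centred_of_mem_projPlane hV ?_ hn.ord_pos
      rw [hn.ord_coord_zero]
      omega

lemma D_nonneg (g₂ : ℂ) : 0 ≤ D g₂ := by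
  intro V
  change (0 : ℤ) ≤ D g₂ V
  rcases mem_projPlane_or_isExceptional' V with hV | ⟨n, h1, h9, hn⟩
  · rw [D_of_mem_projPlane hV]
    have := H_nonneg V
    omega
  · rw [hn.D_eq h1 h9]
    omega

lemma one_mem_globalSections (g₂ : ℂ) : (1 : K) ∈ globalSections (D g₂) := by
  intro _ V
  have := D_nonneg g₂ V
  simpa [divFun] using this

lemma weierstrass_mem_globalSections (g₂ : ℂ) : weierstrass g₂ ∈ globalSections (D g₂) := by
  intro hne V
  have hW := weierstrass_add_ne_zero g₂ 0
  change (0 : ℤ) ≤ V.ord (weierstrass g₂) + D g₂ V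
  rcases mem_projPlane_or_isExceptional' V with hV | ⟨n, h1, h9, hn⟩
  · obtain ⟨s, t, x, -, hx0, hxm, hxq, hxp, hx, -⟩ := exists_chart hV
    have hmem : x ^ 3 * weierstrass g₂ ∈ V.ring := by
      have : x ^ 3 * weierstrass g₂ = x * (x * p) ^ 2 + -(4 * (x * q) ^ 3) +
          algebraMap ℂ K g₂ * x ^ 2 * (x * q) := by
        rw [weierstrass]
        ring
      rw [this]
      have hg := V.algebraMap_mem g₂
      with_reducible repeat' first
        | assumption | apply add_mem | apply mul_mem | apply pow_mem | apply neg_mem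
        | apply ofNat_mem
    have := V.ord_nonneg hmem
    rw [V.ord_mul (pow_ne_zero 3 hx0) hne, V.ord_pow, hx] at this
    rw [D_of_mem_projPlane hV, H, formDivisor_X_zero]
    push_cast at this
    linarith
  · have := hn.ord_weierstrass h1 h9 0
    rw [map_zero, add_zero] at this
    rw [this, hn.D_eq h1 h9]
    omega

/-! ### Finiteness of supports -/

lemma finite_ord_ne_zero (g₂ : ℂ) (g : K) :
    {V : PrimeDivisor (surfaceS g₂) | V.ring.toLocalSubring ∈ projPlane ∧ V.ord g ≠ 0}.Finite := by
  have hq : IsCoordPair q⁻¹ (p / q) := by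
    have h1 := fst_mem_adjoin q⁻¹ (p / q)
    have h2 := snd_mem_adjoin q⁻¹ (p / q)
    have hm : q ∈ IntermediateField.adjoin ℂ (Set.range ![q⁻¹, p / q]) := by
      have h := inv_mem h1
      rwa [inv_inv] at h
    refine isCoordPair_q_p.of_mem hm ?_
    have h := mul_mem h2 hm
    rwa [div_mul_cancel₀ _ q_ne_zero] at h
  refine (((LocalizedAt.finite_ord_ne_zero isCoordPair_q_p g).union
    (LocalizedAt.finite_ord_ne_zero hq g)).union
    (LocalizedAt.finite_ord_ne_zero (isCoordPair_coord g₂ 0) g)).subset ?_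
  rintro V ⟨hV, hg⟩
  rcases mem_projPlane_iff.1 hV with h | h | h
  · exact Or.inl (Or.inl ⟨h, hg⟩)
  · exact Or.inl (Or.inr ⟨h, hg⟩)
  · exact Or.inr ⟨h, hg⟩

lemma finite_isExceptional (g₂ : ℂ) :
    {V : PrimeDivisor (surfaceS g₂) | ∃ n, 1 ≤ n ∧ n ≤ 9 ∧ IsExceptional g₂ n V}.Finite := by
  refine ((Finset.range 10).finite_toSet.biUnion
    (t := fun n => {V : PrimeDivisor (surfaceS g₂) | IsExceptional g₂ n V})
    fun n _ => Set.Subsingleton.finite fun V hV W hW => ?_).subset ?_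
  · exact LocalizedAt.subsingleton (isCoordPair_coord g₂ n) (π := X 1) X_prime
      ⟨hV.localizedAt, by simpa using hV.ord_pos⟩ ⟨hW.localizedAt, by simpa using hW.ord_pos⟩
  · rintro V ⟨n, -, h9, hn⟩
    simp only [Set.mem_iUnion]
    exact ⟨n, by simpa using by omega, hn⟩

lemma finite_support_divFun_add_D (g₂ : ℂ) (g : K) :
    (divFun (surfaceS g₂) g + D g₂).support.Finite := by
  refine (((finite_isExceptional g₂).union (finite_ord_ne_zero g₂ g)).union
    ((finite_ord_ne_zero g₂ q).union (finite_ord_ne_zero g₂ p))).subset fun V hV => ?_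
  rcases mem_projPlane_or_isExceptional' V with h | h
  · by_contra hcon
    simp only [Set.mem_union, not_or, Set.mem_ofPred_eq, not_and, not_not] at hcon
    apply hV
    rw [Pi.add_apply, divFun, hcon.1.2 h, D_of_mem_projPlane h, H, formDivisor_X_zero,
      hcon.2.1 h, hcon.2.2 h]
    simp
  · exact Or.inl (Or.inl h)

end Surface

/-! ### Sections of the anticanonical sheaf -/

section Sections

/-- A polynomial in `u₀ = 1 / p` and `v = q / p` becomes a polynomial in `q` and `p` after
multiplication by a sufficiently large power of `p`. -/
lemma pow_mul_ev_chart (G : MvPolynomial (Fin 2) ℂ) (N : ℕ)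
    (hN : ∀ m ∈ G.support, m 0 + m 1 ≤ N) : p ^ N * ev (1 / p) (q / p) G =
      ev q p (∑ m ∈ G.support, monomial
        (Finsupp.single 0 (m 1) + Finsupp.single 1 (N - (m 0 + m 1))) (coeff m G)) := by
  have hp := p_ne_zero
  rw [map_sum, ev, aeval_def, eval₂_eq', Finset.mul_sum]
  refine Finset.sum_congr rfl fun m hm => ?_
  have hle := hN m hm
  obtain ⟨k, hk⟩ := Nat.exists_eq_add_of_le hle
  rw [ev, aeval_monomial, Finsupp.prod_add_index' (by simp) (fun _ _ _ => pow_add _ _ _),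
    Finsupp.prod_single_index (by simp), Finsupp.prod_single_index (by simp), Fin.prod_univ_two]
  simp only [Matrix.cons_val_zero, Matrix.cons_val_one]
  rw [hk, Nat.add_sub_cancel_left, pow_add, pow_add, div_pow, div_pow, one_pow]
  field_simp

/-- A polynomial in `u₀ = 1 / p` and `v = q / p` such that `p³` times it is a polynomial in `q` and
`p` has degree at most three. -/
lemma coeff_eq_zero_of_pow_three_mul {F G : MvPolynomial (Fin 2) ℂ}
    (h : p ^ 3 * ev (1 / p) (q / p) G = ev q p F) {m : Fin 2 →₀ ℕ} (hm : 3 < m 0 + m 1) :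
    coeff m G = 0 := by
  classical
  by_contra hne
  have hsupp : m ∈ G.support := mem_support_iff.2 hne
  let N := G.support.sup fun m => m 0 + m 1
  have hN : ∀ m ∈ G.support, m 0 + m 1 ≤ N := fun m hm =>
    Finset.le_sup (f := fun m : Fin 2 →₀ ℕ => m 0 + m 1) hm
  have hmN := hN m hsupp
  have h1 := pow_mul_ev_chart G N hN
  have h2 : ev q p (X 1 ^ (N - 3) * F) = p ^ N * ev (1 / p) (q / p) G := by
    rw [map_mul, ← h, map_pow, ev_X_one, ← mul_assoc, ← pow_add]
    congr 2
    omega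
  rw [h1] at h2
  have h3 := congrArg (coeff (Finsupp.single 0 (m 1) + Finsupp.single 1 (N - (m 0 + m 1))))
    (isCoordPair_q_p.ev_injective h2)
  rw [mul_comm, X_pow_eq_monomial, coeff_mul_monomial', if_neg, coeff_sum, Finset.sum_eq_single m] at h3
  · rw [coeff_monomial, if_pos rfl] at h3
    exact hne h3.symm
  · intro k hk hkm
    rw [coeff_monomial, if_neg]
    intro heq
    apply hkm
    have e0 := DFunLike.congr_fun heq 0
    have e1 := DFunLike.congr_fun heq 1
    simp at e0 e1
    have := hN k hk
    ext i
    fin_cases i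
    · change k 0 = m 0
      omega
    · exact e0
  · intro h
    exact absurd hsupp h
  · intro hle
    have := hle 1
    simp at this
    omega

/-- The expansion of a polynomial of degree at most three in two variables. -/
lemma exists_cubic_expansion {G : MvPolynomial (Fin 2) ℂ}
    (hG : ∀ m : Fin 2 →₀ ℕ, 3 < m 0 + m 1 → coeff m G = 0) :
    ∃ c : ℕ → ℕ → ℂ, ∀ s t : K, ev s t G = algebraMap ℂ K (c 0 0) + algebraMap ℂ K (c 0 1) * t +
      algebraMap ℂ K (c 0 2) * t ^ 2 + algebraMap ℂ K (c 0 3) * t ^ 3 + algebraMap ℂ K (c 1 0) * s +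
      algebraMap ℂ K (c 1 1) * (s * t) + algebraMap ℂ K (c 1 2) * (s * t ^ 2) +
      algebraMap ℂ K (c 2 0) * s ^ 2 + algebraMap ℂ K (c 2 1) * (s ^ 2 * t) +
      algebraMap ℂ K (c 3 0) * s ^ 3 := by
  classical
  let e : ℕ × ℕ → (Fin 2 →₀ ℕ) := fun x => Finsupp.single 0 x.1 + Finsupp.single 1 x.2
  have he0 (x) : e x 0 = x.1 := by simp [e]
  have he1 (x) : e x 1 = x.2 := by simp [e]
  have he : Function.Injective e := fun x y hxy =>
    Prod.ext (by rw [← he0, hxy, he0]) (by rw [← he1, hxy, he1])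
  have hz (i j : ℕ) (hij : 3 < i + j) : coeff (e (i, j)) G = 0 :=
    hG _ (by rw [he0, he1]; exact hij)
  refine ⟨fun i j => coeff (e (i, j)) G, fun s t => ?_⟩
  have hsub : G.support ⊆ (Finset.range 4 ×ˢ Finset.range 4).image e := by
    intro m hm
    have hle : m 0 + m 1 ≤ 3 := by
      by_contra hlt
      exact mem_support_iff.1 hm (hG m (by omega))
    refine Finset.mem_image.2 ⟨(m 0, m 1), ?_, ?_⟩
    · simp only [Finset.mem_product, Finset.mem_range]
      omega
    · ext i
      fin_cases i
      · exact he0 _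
      · exact he1 _
  rw [ev, aeval_def, eval₂_eq', Finset.sum_subset hsub, Finset.sum_image he.injOn,
    Finset.sum_product]
  · simp only [Finset.sum_range_succ, Finset.sum_range_zero, Fin.prod_univ_two, he0, he1,
      Matrix.cons_val_zero, Matrix.cons_val_one]
    rw [hz 1 3 (by norm_num), hz 2 2 (by norm_num), hz 2 3 (by norm_num), hz 3 1 (by norm_num),
      hz 3 2 (by norm_num), hz 3 3 (by norm_num)]
    simp only [map_zero]
    ring
  · intro m _ hm
    rw [notMem_support_iff.1 hm, map_zero, zero_mul]

/-- The powers of `v` are linearly independent over `ℂ` modulo higher powers of `v`. -/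
lemma IsExceptional.eq_zero_of_sum_eq {M : Set (LocalSubring K)} {V : PrimeDivisor M} {g₂ : ℂ}
    {n : ℕ} (h : IsExceptional g₂ n V) {k : ℕ} (d : Fin k → ℂ) {w : K} (hw : w ∈ V.ring)
    (hd : ∑ i, algebraMap ℂ K (d i) * (q / p) ^ (i : ℕ) = (q / p) ^ k * w) : d = 0 := by
  induction k with
  | zero => exact Subsingleton.elim _ _
  | succ k ih =>
    have hv0 := q_div_p_ne_zero
    rw [Fin.sum_univ_succ] at hd
    simp only [Fin.val_zero, pow_zero, mul_one, Fin.val_succ] at hd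
    have hsum : ∑ i : Fin k, algebraMap ℂ K (d i.succ) * (q / p) ^ ((i : ℕ) + 1) =
        (q / p) * ∑ i : Fin k, algebraMap ℂ K (d i.succ) * (q / p) ^ (i : ℕ) := by
      rw [Finset.mul_sum]
      refine Finset.sum_congr rfl fun i _ => ?_
      ring
    set r := ∑ i : Fin k, algebraMap ℂ K (d i.succ) * (q / p) ^ (i : ℕ) with hr
    have hrm : r ∈ V.ring := sum_mem fun i _ =>
      V.ring.mul_mem _ _ (V.algebraMap_mem _) (pow_mem h.v_mem _)
    rw [hsum] at hd
    have hd0 : algebraMap ℂ K (d 0) = (q / p) * ((q / p) ^ k * w - r) := by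
      linear_combination hd
    have h0 : d 0 = 0 := by
      by_contra hne
      have h1 : (q / p) ^ k * w - r ∈ V.ring :=
        sub_mem (V.ring.mul_mem _ _ (pow_mem h.v_mem _) hw) hrm
      have h2 := V.ord_algebraMap (d 0)
      have h3 : (q / p) ^ k * w - r ≠ 0 := by
        intro h3
        rw [h3, mul_zero] at hd0
        exact hne (by simpa using hd0)
      rw [hd0, V.ord_mul hv0 h3, h.ord_v] at h2
      have := V.ord_nonneg h1
      omega
    have htail := ih (fun i => d i.succ) (by
      rw [h0, map_zero, zero_add] at hd
      apply mul_left_cancel₀ hv0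
      rw [← hr, hd]
      ring)
    funext i
    refine Fin.cases h0 (fun i => ?_) i
    exact congrFun htail i

/-- A curve of the plane, as a curve on `S`. -/
def strictTransformOfCurve (g₂ : ℂ) {A : ValuationSubring K} (hA : IsDiscreteValuationRing A)
    (h : A.toLocalSubring ∈ projPlane) : PrimeDivisor (surfaceS g₂) :=
  ⟨A, mem_stage_of_mem_projPlane (V := (⟨A, h, hA⟩ : PrimeDivisor projPlane)) h g₂ 9, hA⟩

/-- The last exceptional curve occurs among the prime divisors of `S`. -/
lemma exists_isExceptional_nine (g₂ : ℂ) :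
    ∃ V : PrimeDivisor (surfaceS g₂), IsExceptional g₂ 9 V := by
  have hc := isCoordPair_coord g₂ 9
  have hX : Prime (X 1 : MvPolynomial (Fin 2) ℂ) := X_prime
  have hloc := curveRing_localizedAt hc hX
  -- the same local ring, as a prime divisor on the model consisting of this ring alone
  let W : PrimeDivisor {(curveRing _ _ hc hX).toLocalSubring} :=
    ⟨curveRing _ _ hc hX, rfl, curveRing_isDiscreteValuationRing hc hX⟩
  have hW : IsExceptional g₂ 9 W := by
    refine ⟨hloc, ?_⟩
    rw [W.ord_pos_iff q_div_p_ne_zero]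
    simpa using inv_notMem_curveRing hc hX
  refine ⟨⟨W.ring, ?_, W.dvr⟩, ⟨hloc, hW.ord_pos⟩⟩
  refine Or.inr ⟨Or.inr ?_, ?_⟩
  · rw [coord_snd, ← coord_succ, mem_affineModel_iff]
    exact hloc
  · rw [vanishesAt_coord_iff]
    refine ⟨?_, hW.ord_pos⟩
    have := W.ord_nonneg hloc.fst_mem
    rw [coord_sub_centre, W.ord_mul (isCoordPair_coord g₂ 9).fst_ne_zero q_div_p_ne_zero, hW.ord_v]
    omega

/-- The sections of the sheaf of `D` are the combinations of `1` and `p² - 4 q³ + g₂ q`. -/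
lemma exists_eq_of_mem_globalSections {g₂ : ℂ} {f : K} (hf : f ∈ globalSections (D g₂)) :
    ∃ a b : ℂ, f = algebraMap ℂ K a + algebraMap ℂ K b * weierstrass g₂ := by
  have hp := p_ne_zero
  by_cases hf0 : f = 0
  · exact ⟨0, 0, by simp [hf0]⟩
  have hord (V : PrimeDivisor (surfaceS g₂)) : 0 ≤ V.ord f + D g₂ V := hf hf0 V
  -- `f` has no poles on the affine plane with coordinates `q` and `p`
  obtain ⟨F, hF⟩ : ∃ F, f = ev q p F := by
    refine isCoordPair_q_p.exists_eq_ev fun A hA hloc => ?_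
    have hpl := mem_projPlane_iff.2 (Or.inl hloc)
    let V := strictTransformOfCurve g₂ hA hpl
    have h1 := V.ord_nonneg hloc.fst_mem
    have h2 := V.ord_nonneg hloc.snd_mem
    have h3 := hord V
    rw [D_of_mem_projPlane hpl, H, formDivisor_X_zero] at h3
    exact (V.ord_nonneg_iff hf0).1 (by omega)
  -- `f` has at most a triple pole along the line `u₀ = 0` in the chart at infinity
  obtain ⟨G, hG⟩ : ∃ G, (1 / p) ^ 3 * f = ev (1 / p) (q / p) G := by
    refine (isCoordPair_coord g₂ 0).exists_eq_ev fun A hA hloc => ?_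
    have hpl := mem_projPlane_iff.2 (Or.inr (Or.inr hloc))
    let V := strictTransformOfCurve g₂ hA hpl
    have h1 := V.ord_nonneg hloc.fst_mem
    have h2 := V.ord_nonneg hloc.snd_mem
    have h3 := hord V
    rw [D_of_mem_projPlane hpl, H, formDivisor_X_zero] at h3
    rw [coord_zero, one_div, V.ord_inv] at h1
    rw [V.ord_div q_ne_zero hp] at h2
    have hp3 : ((1 : K) / p) ^ 3 ≠ 0 := pow_ne_zero 3 (one_div_ne_zero hp)
    refine (V.ord_nonneg_iff (mul_ne_zero hp3 hf0)).1 ?_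
    rw [V.ord_mul hp3 hf0, V.ord_pow, one_div, V.ord_inv]
    push_cast
    omega
  have hfG : f = p ^ 3 * ev (1 / p) (q / p) G := by
    rw [← hG]
    field_simp
  obtain ⟨c, hc⟩ := exists_cubic_expansion (G := G) fun m hm =>
    coeff_eq_zero_of_pow_three_mul (hfG.symm.trans hF) hm
  rw [hc] at hG hfG
  -- as `E_9` does not occur in `D`, the function `f` has no pole along this curve
  obtain ⟨V, hV⟩ := exists_isExceptional_nine g₂
  have hfV : f ∈ V.ring := by
    refine (V.ord_nonneg_iff hf0).1 ?_
    have := hord V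
    rw [hV.D_eq (by norm_num) le_rfl] at this
    simpa using this
  set a := algebraMap ℂ K g₂ with ha
  set v := q / p with hv
  set x := (coord g₂ 9).1 with hx
  set z := -16 * a + v ^ 2 * x with hz
  set y := 4 + v ^ 4 * z with hy
  have hu : (1 : K) / p = v ^ 3 * y := by
    rw [coord_zero_eq_pow g₂ le_rfl, coord_three_eq, coord_four_eq_pow g₂ (by norm_num) le_rfl,
      coord_seven_eq, coord_eight_eq]
    ring
  have hvm : v ∈ V.ring := hV.v_mem
  have ham : a ∈ V.ring := V.algebraMap_mem _
  have hxm : x ∈ V.ring := hV.localizedAt.fst_mem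
  have hcm (i j) : algebraMap ℂ K (c i j) ∈ V.ring := V.algebraMap_mem _
  have hzm : z ∈ V.ring := by
    rw [hz, neg_mul]
    with_reducible repeat' first
      | assumption | apply add_mem | apply mul_mem | apply pow_mem | apply neg_mem
      | apply ofNat_mem
  have hym : y ∈ V.ring := by
    rw [hy]
    with_reducible repeat' first
      | assumption | apply add_mem | apply mul_mem | apply pow_mem | apply ofNat_mem
  -- the expansion of the cubic form in powers of `v` along the last exceptional curve
  have hd := hV.eq_zero_of_sum_eq ![c 0 0, c 0 1, c 0 2, c 0 3 + 4 * c 1 0, 4 * c 1 1, 4 * c 1 2,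
    16 * c 2 0, 16 * c 2 1 - 16 * g₂ * c 1 0, -16 * g₂ * c 1 1]
    (w := y ^ 3 * f + -(algebraMap ℂ K (c 1 0) * x + algebraMap ℂ K (c 1 1) * (v * x) +
      algebraMap ℂ K (c 1 2) * z + algebraMap ℂ K (c 2 0) * (8 * v * z + v ^ 5 * z ^ 2) +
      algebraMap ℂ K (c 2 1) * (8 * v ^ 2 * z + v ^ 6 * z ^ 2) +
      algebraMap ℂ K (c 3 0) * y ^ 3)) (by
      with_reducible repeat' first
        | assumption | apply hcm | apply add_mem | apply mul_mem | apply pow_mem | apply neg_mem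
        | apply ofNat_mem) (by
      rw [← hv]
      rw [hu] at hG
      simp only [Fin.sum_univ_succ, Matrix.cons_val_zero, Matrix.cons_val_succ, Fin.val_zero,
        Fin.val_succ, Finset.univ_eq_empty, Finset.sum_empty, map_add, map_sub, map_mul, map_neg,
        map_ofNat]
      rw [← ha]
      linear_combination -hG)
  have e0 : c 0 0 = 0 := congrFun hd 0
  have e1 : c 0 1 = 0 := congrFun hd 1
  have e2 : c 0 2 = 0 := congrFun hd 2
  have e3 : c 0 3 + 4 * c 1 0 = 0 := congrFun hd 3
  have e4 : 4 * c 1 1 = 0 := congrFun hd 4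
  have e5 : 4 * c 1 2 = 0 := congrFun hd 5
  have e6 : 16 * c 2 0 = 0 := congrFun hd 6
  have e7 : 16 * c 2 1 - 16 * g₂ * c 1 0 = 0 := congrFun hd 7
  have f3 : c 0 3 = -4 * c 1 0 := by linear_combination e3
  have f4 : c 1 1 = 0 := by linear_combination e4 / 4
  have f5 : c 1 2 = 0 := by linear_combination e5 / 4
  have f6 : c 2 0 = 0 := by linear_combination e6 / 16
  have f7 : c 2 1 = g₂ * c 1 0 := by linear_combination e7 / 16
  refine ⟨c 3 0, c 1 0, ?_⟩
  rw [hfG, e0, e1, e2, f3, f4, f5, f6, f7, hv, weierstrass]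
  simp only [map_zero, map_mul, map_neg, map_ofNat, ← ha]
  field_simp
  ring

end Sections

/-! ### The anticanonical pencil -/

section Pencil

variable {g₂ : ℂ}

/-- The section `x₁ + x₀ (p² - 4 q³ + g₂ q)` with coordinates `(x₀, x₁)`. -/
def pencilSection (g₂ : ℂ) : (Fin 2 → ℂ) →ₗ[ℂ] K where
  toFun x := algebraMap ℂ K (x 1) + algebraMap ℂ K (x 0) * weierstrass g₂
  map_add' x y := by
    simp only [Pi.add_apply, map_add]
    ring
  map_smul' c x := by
    simp only [Pi.smul_apply, smul_eq_mul, map_mul, RingHom.id_apply, Algebra.smul_def]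
    ring

lemma pencilSection_apply (x : Fin 2 → ℂ) : pencilSection g₂ x =
    algebraMap ℂ K (x 1) + algebraMap ℂ K (x 0) * weierstrass g₂ := rfl

lemma pencilSection_injective : Function.Injective (pencilSection g₂) := by
  rw [injective_iff_map_eq_zero]
  intro x hx
  rw [pencilSection_apply] at hx
  have h0 : x 0 = 0 := by
    by_contra h0
    refine weierstrass_add_ne_zero g₂ (x 1 / x 0) ?_
    have h0' : algebraMap ℂ K (x 0) ≠ 0 := by simpa using h0
    rw [map_div₀]
    field_simp
    linear_combination hx
  rw [h0, map_zero, zero_mul, add_zero, map_eq_zero] at hx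
  ext i
  fin_cases i
  · exact h0
  · exact hx

lemma pencilSection_ne_zero {x : Fin 2 → ℂ} (hx : x ≠ 0) : pencilSection g₂ x ≠ 0 :=
  (map_ne_zero_iff _ pencilSection_injective).2 hx

/-- The member of the pencil that is defined by the section with coordinates `x`. -/
def pencilMember (g₂ : ℂ) (x : Fin 2 → ℂ) : FormalDivisor (surfaceS g₂) :=
  divFun (surfaceS g₂) (pencilSection g₂ x) + D g₂

lemma divFun_mul {M : Set (LocalSubring K)} {f g : K} (hf : f ≠ 0) (hg : g ≠ 0) :
    divFun M (f * g) = divFun M f + divFun M g :=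
  funext fun V => V.ord_mul hf hg

lemma divFun_algebraMap {M : Set (LocalSubring K)} (c : ℂ) : divFun M (algebraMap ℂ K c) = 0 :=
  funext fun V => V.ord_algebraMap c

lemma pencilMember_smul {c : ℂ} (hc : c ≠ 0) {x : Fin 2 → ℂ} (hx : x ≠ 0) :
    pencilMember g₂ (c • x) = pencilMember g₂ x := by
  rw [pencilMember, map_smul, Algebra.smul_def,
    divFun_mul (by simpa using hc) (pencilSection_ne_zero hx), divFun_algebraMap, zero_add,
    pencilMember]

lemma pencilMember_zero_one : pencilMember g₂ ![0, 1] = D g₂ := by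
  rw [pencilMember, pencilSection_apply]
  simp only [Matrix.cons_val_zero, Matrix.cons_val_one, map_zero, zero_mul, add_zero]
  rw [divFun_algebraMap, zero_add]

lemma pencilMember_one (g₃ : ℂ) : pencilMember g₂ ![1, g₃] = weierstrassStrict g₂ g₃ := by
  rw [pencilMember, pencilSection_apply, weierstrassStrict_eq]
  simp only [Matrix.cons_val_zero, Matrix.cons_val_one, map_one, one_mul]
  rw [add_comm (algebraMap ℂ K g₃)]

lemma pencilMember_mem {x : Fin 2 → ℂ} (hx : x ≠ 0) : pencilMember g₂ x = D g₂ ∨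
    ∃ g₃, pencilMember g₂ x = weierstrassStrict g₂ g₃ := by
  by_cases h0 : x 0 = 0
  · left
    have h1 : x 1 ≠ 0 := by
      intro h1
      apply hx
      ext i
      fin_cases i
      · exact h0
      · exact h1
    have : x = x 1 • ![0, 1] := by
      ext i
      fin_cases i <;> simp [h0]
    rw [this, pencilMember_smul h1 (by simp), pencilMember_zero_one]
  · right
    refine ⟨x 1 / x 0, ?_⟩
    have : x = x 0 • ![1, x 1 / x 0] := by
      ext i
      fin_cases i
      · simp
      · simp [mul_div_cancel₀ _ h0]
    nth_rw 1 [this]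
    rw [pencilMember_smul h0 (by simp), pencilMember_one]

/-- A member of the pencil determines its defining section up to a constant factor, because a
function without zeros and poles on the affine plane is constant. -/
lemma exists_smul_of_pencilMember_eq {x y : Fin 2 → ℂ} (hx : x ≠ 0) (hy : y ≠ 0)
    (h : pencilMember g₂ x = pencilMember g₂ y) : ∃ c : ℂ, c • y = x := by
  have hsx := pencilSection_ne_zero (g₂ := g₂) hx
  have hsy := pencilSection_ne_zero (g₂ := g₂) hy
  have hord (V : PrimeDivisor (surfaceS g₂)) :
      V.ord (pencilSection g₂ x) = V.ord (pencilSection g₂ y) := by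
    have := congrFun h V
    simpa [pencilMember, divFun] using this
  have key {x y : Fin 2 → ℂ} (hsx : pencilSection g₂ x ≠ 0) (hsy : pencilSection g₂ y ≠ 0)
      (hord : ∀ V : PrimeDivisor (surfaceS g₂),
        V.ord (pencilSection g₂ x) = V.ord (pencilSection g₂ y)) :
      ∃ a, pencilSection g₂ x / pencilSection g₂ y = ev q p a := by
    refine isCoordPair_q_p.exists_eq_ev fun A hA hloc => ?_
    have hpl := mem_projPlane_iff.2 (Or.inl hloc)
    let V := strictTransformOfCurve g₂ hA hpl
    refine (V.ord_nonneg_iff (div_ne_zero hsx hsy)).1 ?_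
    rw [V.ord_div hsx hsy, hord V, sub_self]
  obtain ⟨a, ha⟩ := key hsx hsy hord
  obtain ⟨b, hb⟩ := key hsy hsx fun V => (hord V).symm
  have hab : a * b = 1 := by
    apply isCoordPair_q_p.ev_injective
    rw [map_mul, ← ha, ← hb, map_one]
    field_simp
  obtain ⟨c, -, rfl⟩ := isUnit_iff_eq_C_of_isReduced.1 (IsUnit.of_mul_eq_one b hab)
  refine ⟨c, pencilSection_injective (g₂ := g₂) ?_⟩
  rw [div_eq_iff hsy, ev_C] at ha
  rw [map_smul, Algebra.smul_def, ha]

variable {h : K}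

lemma antiK_eq (hh : h ≠ 0) (hω : wedge q p ≠ 0) :
    antiK g₂ (h • wedge q p) = D g₂ - divFun (surfaceS g₂) h := by
  funext V
  change -V.ordForm (h • wedge q p) = D g₂ V - V.ord h
  rw [ordForm_smul_wedge V hh hω]
  ring

lemma mem_globalSections_iff (hh : h ≠ 0) {f : K} :
    f ∈ globalSections (D g₂ - divFun (surfaceS g₂) h) ↔ ∃ x, h * pencilSection g₂ x = f := by
  have hdiv {f : K} (hf : f ≠ 0) : divFun (surfaceS g₂) f + (D g₂ - divFun (surfaceS g₂) h) =
      divFun (surfaceS g₂) (f / h) + D g₂ := by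
    have := divFun_mul (M := surfaceS g₂) (div_ne_zero hf hh) hh
    rw [div_mul_cancel₀ _ hh] at this
    rw [this]
    abel
  constructor
  · intro hf
    have hmem : f / h ∈ globalSections (D g₂) := by
      intro hne
      have hf0 : f ≠ 0 := fun h0 => hne (by rw [h0, zero_div])
      rw [← hdiv hf0]
      exact hf hf0
    obtain ⟨a, b, hab⟩ := exists_eq_of_mem_globalSections hmem
    refine ⟨![b, a], ?_⟩
    rw [pencilSection_apply]
    simp only [Matrix.cons_val_zero, Matrix.cons_val_one]
    rw [← hab, mul_div_cancel₀ _ hh]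
  · rintro ⟨x, rfl⟩ hne
    rw [hdiv hne, mul_div_cancel_left₀ _ hh]
    have hmem : pencilSection g₂ x ∈ globalSections (D g₂) := by
      rw [pencilSection_apply, ← Algebra.smul_def, ← mul_one (algebraMap ℂ K (x 1)),
        ← Algebra.smul_def]
      exact add_mem (Submodule.smul_mem _ _ (one_mem_globalSections g₂))
        (Submodule.smul_mem _ _ (weierstrass_mem_globalSections g₂))
    exact hmem (right_ne_zero_of_mul hne)

lemma divFun_mul_pencilSection (hh : h ≠ 0) {x : Fin 2 → ℂ} (hx : x ≠ 0) :
    divFun (surfaceS g₂) (h * pencilSection g₂ x) + (D g₂ - divFun (surfaceS g₂) h) =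
      pencilMember g₂ x := by
  rw [divFun_mul hh (pencilSection_ne_zero hx), pencilMember]
  abel

lemma mem_linearSystem_iff (hh : h ≠ 0) {D' : FormalDivisor (surfaceS g₂)} :
    D' ∈ linearSystem (D g₂ - divFun (surfaceS g₂) h) ↔ ∃ x, x ≠ 0 ∧ pencilMember g₂ x = D' := by
  constructor
  · rintro ⟨-, h0, f, hf, hD'⟩
    rw [sub_eq_iff_eq_add] at hD'
    obtain ⟨x, rfl⟩ := (mem_globalSections_iff hh).1 fun _ => hD' ▸ h0
    have hx : x ≠ 0 := by
      rintro rfl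
      simp at hf
    exact ⟨x, hx, by rw [hD', divFun_mul_pencilSection hh hx]⟩
  · rintro ⟨x, hx, rfl⟩
    have hne := mul_ne_zero hh (pencilSection_ne_zero (g₂ := g₂) hx)
    refine ⟨finite_support_divFun_add_D g₂ _, ?_, _, hne, ?_⟩
    · rw [← divFun_mul_pencilSection hh hx]
      exact (mem_globalSections_iff hh).2 ⟨x, rfl⟩ hne
    · rw [← divFun_mul_pencilSection hh hx, add_sub_cancel_right]

/-- The coordinates on the space of sections, sending `h (x₁ + x₀ (p² - 4 q³ + g₂ q))` to
`(x₀, x₁)`. -/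
def sectionsEquiv (g₂ : ℂ) (hh : h ≠ 0) :
    globalSections (D g₂ - divFun (surfaceS g₂) h) ≃ₗ[ℂ] (Fin 2 → ℂ) :=
  (LinearEquiv.ofBijective
    (((LinearMap.mulLeft ℂ h).comp (pencilSection g₂)).codRestrict
      (globalSections (D g₂ - divFun (surfaceS g₂) h))
      fun x => (mem_globalSections_iff hh).2 ⟨x, rfl⟩)
    ⟨fun x y hxy => pencilSection_injective (mul_left_cancel₀ hh (congrArg Subtype.val hxy)),
      fun f => by
        obtain ⟨x, hx⟩ := (mem_globalSections_iff hh).1 f.2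
        exact ⟨x, Subtype.ext hx⟩⟩).symm

lemma mul_pencilSection_sectionsEquiv (hh : h ≠ 0)
    (s : globalSections (D g₂ - divFun (surfaceS g₂) h)) :
    h * pencilSection g₂ (sectionsEquiv g₂ hh s) = s :=
  congrArg Subtype.val ((sectionsEquiv g₂ hh).symm_apply_apply s)

variable (g₂) in
/-- The parametrization of the linear system by the projective line. -/
def pencilMap (hh : h ≠ 0) (ℓ : ℙ ℂ (Fin 2 → ℂ)) :
    linearSystem (D g₂ - divFun (surfaceS g₂) h) :=
  ⟨pencilMember g₂ ℓ.rep, (mem_linearSystem_iff hh).2 ⟨ℓ.rep, ℓ.rep_nonzero, rfl⟩⟩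

lemma pencilMap_mk (hh : h ≠ 0) {x : Fin 2 → ℂ} (hx : x ≠ 0) :
    (pencilMap g₂ hh (Projectivization.mk ℂ x hx) : FormalDivisor (surfaceS g₂)) =
      pencilMember g₂ x := by
  obtain ⟨c, hc⟩ := Projectivization.exists_smul_eq_mk_rep ℂ x hx
  change pencilMember g₂ (Projectivization.mk ℂ x hx).rep = _
  rw [← hc]
  exact pencilMember_smul c.ne_zero hx

lemma pencilMap_bijective (hh : h ≠ 0) : Function.Bijective (pencilMap g₂ hh) := by
  constructor
  · intro ℓ
    induction ℓ using Projectivization.ind with | h x hx => ?_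
    intro m
    induction m using Projectivization.ind with | h y hy => ?_
    intro heq
    have := congrArg Subtype.val heq
    rw [pencilMap_mk, pencilMap_mk] at this
    rw [Projectivization.mk_eq_mk_iff']
    exact exists_smul_of_pencilMember_eq hx hy this
  · rintro ⟨D', hD'⟩
    obtain ⟨x, hx, rfl⟩ := (mem_linearSystem_iff hh).1 hD'
    exact ⟨Projectivization.mk ℂ x hx, Subtype.ext (pencilMap_mk hh hx)⟩

end Pencil

end AutP1

end

theorem mainTheorem4 (g₂ : ℂ) (η : AutP1.TwoForm) (hη : η ≠ 0) :
    AutP1.linearSystemDim (AutP1.antiK g₂ η) = 1 ∧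
    AutP1.linearSystem (AutP1.antiK g₂ η) =
      {AutP1.D g₂} ∪ Set.range (fun g₃ : ℂ => AutP1.weierstrassStrict g₂ g₃) ∧
    ∃ Φ : AutP1.linearSystem (AutP1.antiK g₂ η) ≃
        Projectivization ℂ (Fin 2 → ℂ),
      AutP1.IsProjectiveIso (AutP1.antiK g₂ η) Φ ∧
      (∃ hD : AutP1.D g₂ ∈ AutP1.linearSystem (AutP1.antiK g₂ η),
        Φ ⟨AutP1.D g₂, hD⟩ = AutP1.point 0 1 (by simp)) ∧
      ∀ g₃ : ℂ, ∃ hC : AutP1.weierstrassStrict g₂ g₃ ∈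
          AutP1.linearSystem (AutP1.antiK g₂ η),
        Φ ⟨AutP1.weierstrassStrict g₂ g₃, hC⟩ = AutP1.point 1 g₃ (by simp) := by
  obtain ⟨h, rfl⟩ := AutP1.isCoordPair_q_p.exists_eq_smul_wedge η
  obtain ⟨hh, hω⟩ := smul_ne_zero_iff.1 hη
  rw [AutP1.antiK_eq hh hω]
  have hD : AutP1.D g₂ ∈ AutP1.linearSystem (AutP1.D g₂ - AutP1.divFun (AutP1.surfaceS g₂) h) :=
    (AutP1.mem_linearSystem_iff hh).2 ⟨![0, 1], by simp, AutP1.pencilMember_zero_one⟩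
  have hC (g₃ : ℂ) : AutP1.weierstrassStrict g₂ g₃ ∈
      AutP1.linearSystem (AutP1.D g₂ - AutP1.divFun (AutP1.surfaceS g₂) h) :=
    (AutP1.mem_linearSystem_iff hh).2 ⟨![1, g₃], by simp, AutP1.pencilMember_one g₃⟩
  refine ⟨?_, ?_, (Equiv.ofBijective _ (AutP1.pencilMap_bijective hh)).symm, ?_, ⟨hD, ?_⟩,
    fun g₃ => ⟨hC g₃, ?_⟩⟩
  · rw [AutP1.linearSystemDim, (AutP1.sectionsEquiv g₂ hh).finrank_eq, Module.finrank_fin_fun]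
    norm_num
  · ext D'
    constructor
    · intro hD'
      obtain ⟨x, hx, rfl⟩ := (AutP1.mem_linearSystem_iff hh).1 hD'
      rcases AutP1.pencilMember_mem (g₂ := g₂) hx with h1 | ⟨g₃, h1⟩
      · exact Or.inl h1
      · exact Or.inr ⟨g₃, h1.symm⟩
    · rintro (rfl | ⟨g₃, rfl⟩)
      · exact hD
      · exact hC g₃
  · refine ⟨AutP1.sectionsEquiv g₂ hh, fun s hs D' hD' => ?_⟩
    rw [Equiv.symm_apply_eq, Equiv.ofBijective_apply]
    refine Subtype.ext ?_
    rw [AutP1.pencilMap_mk, hD', ← AutP1.mul_pencilSection_sectionsEquiv hh s,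
      AutP1.divFun_mul_pencilSection hh ((AutP1.sectionsEquiv g₂ hh).map_ne_zero_iff.2 hs)]
  · rw [Equiv.symm_apply_eq, Equiv.ofBijective_apply]
    exact Subtype.ext ((AutP1.pencilMap_mk hh _).trans AutP1.pencilMember_zero_one).symm
  · rw [Equiv.symm_apply_eq, Equiv.ofBijective_apply]
    exact Subtype.ext ((AutP1.pencilMap_mk hh _).trans (AutP1.pencilMember_one g₃)).symm
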